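/- Let $k$ be a commutative ring with unit, let $r,s\ge 0$ be integers, and let $\delta\in k$ be invertible. A walled Brauer $(r+s)$-diagram is a graph on two columns (left and right) of $r+s$ vertices each in which every vertex lies on exactly one edge, such that an edge joining the two columns joins either two vertices that are both among the first $r$ vertices of their columns or two vertices that are both among the last $s$ vertices of their columns, and an edge joining two vertices of the same column joins one of the first $r$ vertices to one of the last $s$ vertices. The walled Brauer algebra $\mathcal{B}_{r,s}(\delta)$ is the free $k$-module on these diagrams, with $k$-bilinear product $d_1d_2=\delta^{\alpha}d_3$: identify the right-hand column of $d_1$ with the left-hand column of $d_2$; $\alpha$ is the number of closed loops in the resulting middle column, and $d_3$ joins two distinct outer vertices by an edge exactly when they are connected by a path. Let $\mathbb{1}$ denote the ground ring $k$, as a left and as a right $\mathcal{B}_{r,s}(\delta)$-module, on which a diagram acts as $1$ if all its edges join the two columns and as $0$ otherwise. Then there exist isomorphisms of graded $k$-modules $$\operatorname{Tor}_{*}^{\mathcal{B}_{r,s}(\delta)}(\mathbb{1},\mathbb{1})\cong H_{*}(\Sigma_r\times\Sigma_s;k)\qquad\text{and}\qquad \operatorname{Ext}^{*}_{\mathcal{B}_{r,s}(\delta)}(\mathbb{1},\mathbb{1})\cong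 H^{*}(\Sigma_r\times\Sigma_s;k),$$ where $\Sigma_m$ is the symmetric group on $m$ letters and the right-hand sides are group homology and group cohomology with trivial coefficients $k$. -/

import Mathlib

universe u

/-! ### Homology and cohomology of augmented algebras -/

namespace AugmentedAlgebra

open CategoryTheory TensorProduct
open scoped ModuleCat.Algebra

noncomputable section

variable (k : Type u) [CommRing k] {A : Type u} [Ring A] [Algebra k A]

/-- The relations `m a ⊗ n = m ⊗ a n` which cut out `M ⊗_A N` as a quotient of `M ⊗_k N`, for a
right `A`-module `M` and a left `A`-module `N`. Right `A`-modules are modules over the opposite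
algebra, and `M`, `N` are `k`-modules through `k → A`. -/
def balancedRelations (M : ModuleCat.{u} Aᵐᵒᵖ) (N : ModuleCat.{u} A) : Submodule k (M ⊗[k] N) :=
  Submodule.span k
    {t | ∃ (a : A) (m : M) (n : N), t = (MulOpposite.op a • m) ⊗ₜ[k] n - m ⊗ₜ[k] (a • n)}

/-- The functor `M ⊗_A -` from left `A`-modules to `k`-modules, for a right `A`-module `M`. -/
def tensorFunctor (M : ModuleCat.{u} Aᵐᵒᵖ) : ModuleCat.{u} A ⥤ ModuleCat.{u} k where
  obj N := ModuleCat.of k ((M ⊗[k] N) ⧸ balancedRelations k M N)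
  map {N N'} f := ModuleCat.ofHom <|
    Submodule.mapQ (balancedRelations k M N) (balancedRelations k M N')
      (LinearMap.lTensor M (f.hom.restrictScalars k)) (by
        refine Submodule.span_le.2 ?_
        rintro _ ⟨a, m, n, rfl⟩
        refine Submodule.subset_span ⟨a, m, f.hom n, ?_⟩
        simp)
  map_id N := by
    ext x y
    simp
  map_comp f g := by
    ext x y
    rfl

instance (M : ModuleCat.{u} Aᵐᵒᵖ) : (tensorFunctor k M).Additive where
  map_add {N N'} {f g} := by
    refine ModuleCat.hom_ext ?_
    rw [ModuleCat.hom_add]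
    refine Submodule.linearMap_qext _ (TensorProduct.ext' fun x y => ?_)
    exact congrArg Submodule.Quotient.mk (TensorProduct.tmul_add x (f.hom y) (g.hom y))

/-- `Tor_n^A(M, N)`: the `n`-th left derived functor of `M ⊗_A -`, evaluated at `N`. -/
def tor (M : ModuleCat.{u} Aᵐᵒᵖ) (N : ModuleCat.{u} A) (n : ℕ) : ModuleCat.{u} k :=
  ((tensorFunctor k M).leftDerived n).obj N

/-- `Ext^n_A(M, N)` in the category of left `A`-modules, as a `k`-module. -/
def ext (M N : ModuleCat.{u} A) (n : ℕ) : ModuleCat.{u} k :=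
  ((Ext k (ModuleCat.{u} A) n).obj (Opposite.op M)).obj N

variable {k}

/-- The trivial left `A`-module: the ground ring `k`, on which `A` acts via the augmentation. -/
def trivialLeft (τ : A →ₐ[k] k) : ModuleCat.{u} A :=
  (ModuleCat.restrictScalars (τ : A →+* k)).obj (ModuleCat.of k k)

/-- The trivial right `A`-module: the ground ring `k`, on which `A` acts via the augmentation. -/
def trivialRight (τ : A →ₐ[k] k) : ModuleCat.{u} Aᵐᵒᵖ :=
  (ModuleCat.restrictScalars
    (τ.fromOpposite fun _ _ => Commute.all _ _ : Aᵐᵒᵖ →+* k)).obj (ModuleCat.of k k)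

/-- The homology of an algebra `A` with augmentation `τ`: `Tor_n^A(1, 1)`. -/
def homology (τ : A →ₐ[k] k) (n : ℕ) : ModuleCat.{u} k :=
  tor k (trivialRight τ) (trivialLeft τ) n

/-- The cohomology of an algebra `A` with augmentation `τ`: `Ext^n_A(1, 1)`. -/
def cohomology (τ : A →ₐ[k] k) (n : ℕ) : ModuleCat.{u} k :=
  ext k (trivialLeft τ) (trivialLeft τ) n

end

end AugmentedAlgebra

/-! ### Auxiliary facts on graphs and involutions -/

namespace SimpleGraph

/-- If two involutions of a finite set have no common fixed point, then in the graph which joins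
each point to its two images every component that contains a fixed point of one of the
involutions contains exactly one other such point. -/
theorem existsUnique_end_aux {α : Type*} [Finite α] (σ τ : Equiv.Perm α)
    (hσ : ∀ x, σ (σ x) = x) (hτ : ∀ x, τ (τ x) = x) (hd : ∀ x, σ x = x → τ x ≠ x)
    (G : SimpleGraph α) (hG : ∀ x y, G.Adj x y ↔ x ≠ y ∧ (σ x = y ∨ τ x = y))
    (x : α) (hx : τ x = x) :
    ∃! y, y ≠ x ∧ G.Reachable x y ∧ (σ y = y ∨ τ y = y) := by
  set ρ : Equiv.Perm α := σ * τ with hρ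
  have hσ' : σ⁻¹ = σ := by ext z; rw [Equiv.Perm.inv_eq_iff_eq, hσ]
  have hτ' : τ⁻¹ = τ := by ext z; rw [Equiv.Perm.inv_eq_iff_eq, hτ]
  have hτρ : τ * ρ * τ⁻¹ = ρ⁻¹ := by
    rw [hρ, mul_inv_rev, hσ', hτ']
    ext z; simp [hτ]
  have hτρi : ∀ i : ℤ, τ ((ρ ^ i) x) = (ρ ^ (-i)) x := by
    intro i
    have h1 : τ * ρ ^ i * τ⁻¹ = ρ ^ (-i) := by
      rw [← conj_zpow, hτρ, inv_zpow, zpow_neg]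
    rw [← h1]
    simp [hτ', hx]
  have hστ : ∀ z, σ z = ρ (τ z) := by intro z; simp [hρ, hτ]
  have hσρi : ∀ i : ℤ, σ ((ρ ^ i) x) = (ρ ^ (1 - i)) x := by
    intro i
    rw [hστ, hτρi, sub_eq_add_neg, zpow_add ρ 1, zpow_one, Equiv.Perm.mul_apply]
    rfl
  have hadjσ : ∀ z, G.Reachable z (σ z) := by
    intro z
    by_cases h : z = σ z
    · rw [← h]
    · exact Adj.reachable ((hG _ _).2 ⟨h, Or.inl rfl⟩)
  have hadjτ : ∀ z, G.Reachable z (τ z) := by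
    intro z
    by_cases h : z = τ z
    · rw [← h]
    · exact Adj.reachable ((hG _ _).2 ⟨h, Or.inr rfl⟩)
  have hreach : ∀ y, G.Reachable x y ↔ ∃ i : ℤ, (ρ ^ i) x = y := by
    intro y
    constructor
    · rw [reachable_iff_reflTransGen]
      intro h
      induction h with
      | refl => exact ⟨0, by simp⟩
      | tail _ hbc ih =>
        obtain ⟨i, rfl⟩ := ih
        rcases ((hG _ _).1 hbc).2 with rfl | rfl
        · exact ⟨1 - i, (hσρi i).symm⟩
        · exact ⟨-i, (hτρi i).symm⟩
    · have hnat : ∀ n : ℕ, G.Reachable x ((ρ ^ (n : ℤ)) x) := by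
        intro n
        induction n with
        | zero => simp
        | succ n ih =>
          refine ih.trans ?_
          rw [Nat.cast_succ, add_comm, zpow_add, zpow_one, Equiv.Perm.mul_apply]
          exact (hadjτ _).trans (hadjσ _)
      rintro ⟨i, rfl⟩
      obtain ⟨n, rfl | rfl⟩ := i.eq_nat_or_neg
      · exact hnat n
      · rw [← hτρi]
        exact (hnat n).trans (hadjτ _)
  obtain ⟨m, hm⟩ : ∃ m : ℤ, m = (Function.minimalPeriod (ρ • ·) x : ℤ) := ⟨_, rfl⟩
  have hper : ∀ i j : ℤ, (ρ ^ i) x = (ρ ^ j) x ↔ m ∣ i - j := by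
    intro i j
    rw [hm, ← MulAction.zpow_smul_eq_iff_minimalPeriod_dvd, Equiv.Perm.smul_def]
    rw [sub_eq_add_neg, add_comm, zpow_add, Equiv.Perm.mul_apply, zpow_neg,
      Equiv.Perm.inv_eq_iff_eq]
  have hper0 : ∀ i : ℤ, (ρ ^ i) x = x ↔ m ∣ i := by
    intro i
    simpa using hper i 0
  have hm0 : m ≠ 0 := by
    rw [hm]
    have : x ∈ Function.periodicPts (ρ • ·) := by
      refine Function.Injective.mem_periodicPts (f := (ρ • ·)) ?_ x
      exact MulAction.injective ρ
    exact_mod_cast (Function.minimalPeriod_pos_of_mem_periodicPts this).ne'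
  have hfτ : ∀ i : ℤ, τ ((ρ ^ i) x) = (ρ ^ i) x ↔ m ∣ 2 * i := by
    intro i
    rw [hτρi, hper, ← dvd_neg]
    ring_nf
  have hfσ : ∀ i : ℤ, σ ((ρ ^ i) x) = (ρ ^ i) x ↔ m ∣ 2 * i - 1 := by
    intro i
    rw [hσρi, hper, ← dvd_neg]
    ring_nf
  have hne : ¬ m ∣ 1 := by
    intro h
    refine hd x ?_ hx
    have := (hfσ 0).2 (by simpa using h)
    simpa using this
  rcases Int.even_or_odd' m with ⟨h, hh | hh⟩
  · refine ⟨(ρ ^ h) x, ⟨?_, (hreach _).2 ⟨h, rfl⟩, Or.inr ((hfτ _).2 ⟨1, by lia⟩)⟩, ?_⟩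
    · rw [Ne, hper0]
      rintro ⟨c, hc⟩
      rw [hh] at hc
      have h0 : h ≠ 0 := by rintro rfl; exact hm0 (by simpa using hh)
      have : h * (2 * c - 1) = 0 := by linear_combination -hc
      rcases mul_eq_zero.1 this with h1 | h1
      · exact h0 h1
      · lia
    · rintro y ⟨hyx, hy, hf⟩
      obtain ⟨i, rfl⟩ := (hreach y).1 hy
      rw [Ne, hper0] at hyx
      rw [hper]
      rw [hfσ, hfτ] at hf
      rcases hf with ⟨c, hc⟩ | ⟨c, hc⟩
      · rw [hh, mul_assoc] at hc
        lia
      · rw [hh, mul_assoc] at hc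
        have hc' : i = h * c := by lia
        rcases Int.even_or_odd' c with ⟨e, he | he⟩
        · exact absurd ⟨e, by rw [hc', hh, he]; ring⟩ hyx
        · exact ⟨e, by rw [hc', hh, he]; ring⟩
  · have hodd : ∀ i : ℤ, m ∣ 2 * i → m ∣ i := by
      intro i hi
      have h1 : m ∣ m * i - h * (2 * i) := dvd_sub ⟨i, rfl⟩ (hi.mul_left h)
      have h2 : m * i - h * (2 * i) = i := by rw [hh]; ring
      rwa [h2] at h1
    refine ⟨(ρ ^ (h + 1)) x, ⟨?_, (hreach _).2 ⟨_, rfl⟩, Or.inl ((hfσ _).2 ⟨1, by lia⟩)⟩, ?_⟩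
    · rw [Ne, hper0]
      intro hc
      apply hne
      have h1 : m ∣ m - 2 * h := by rw [hh]; simpa [hh] using (by
        have h3 := dvd_sub (hc.mul_left 2) (dvd_refl m)
        have h4 : 2 * (h + 1) - m = 1 := by lia
        rwa [h4] at h3 : m ∣ 1)
      have h2 : m - 2 * h = 1 := by lia
      rwa [h2] at h1
    · rintro y ⟨hyx, hy, hf⟩
      obtain ⟨i, rfl⟩ := (hreach y).1 hy
      rw [Ne, hper0] at hyx
      rw [hper]
      rw [hfσ, hfτ] at hf
      rcases hf with hf | hf
      · apply hodd
        have h3 := dvd_sub hf (dvd_refl m)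
        have h4 : 2 * i - 1 - m = 2 * (i - (h + 1)) := by lia
        rwa [h4] at h3
      · exact absurd (hodd _ hf) hyx

theorem existsUnique_end {α : Type*} [Finite α] (σ τ : Equiv.Perm α)
    (hσ : ∀ x, σ (σ x) = x) (hτ : ∀ x, τ (τ x) = x) (hd : ∀ x, σ x = x → τ x ≠ x)
    (G : SimpleGraph α) (hG : ∀ x y, G.Adj x y ↔ x ≠ y ∧ (σ x = y ∨ τ x = y))
    (x : α) (hx : σ x = x ∨ τ x = x) :
    ∃! y, y ≠ x ∧ G.Reachable x y ∧ (σ y = y ∨ τ y = y) := by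
  rcases hx with hx | hx
  · have := existsUnique_end_aux τ σ hτ hσ (fun z h h' => hd z h' h) G
      (fun a b => by rw [hG, or_comm (a := σ a = b)]) x hx
    simpa only [or_comm] using this
  · exact existsUnique_end_aux σ τ hσ hτ hd G hG x hx

theorem Reachable.of_map {X Z : Type*} (ψ : X ↪ Z) (K : SimpleGraph X) {u v : Z}
    (h : (K.map ψ).Reachable u v) : u = v ∨ ∃ a b, ψ a = u ∧ ψ b = v ∧ K.Reachable a b := by
  rw [reachable_iff_reflTransGen] at h
  induction h with
  | refl => exact Or.inl rfl
  | tail _ hbc ih =>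
    obtain ⟨b, c, hadj, rfl, rfl⟩ := (map_adj ψ K _ _).1 hbc
    rcases ih with rfl | ⟨a, b', rfl, hb, hr⟩
    · exact Or.inr ⟨b, c, rfl, rfl, hadj.reachable⟩
    · obtain rfl := ψ.injective hb
      exact Or.inr ⟨a, c, rfl, rfl, hr.trans hadj.reachable⟩

/-- Replacing a part of a graph by its connectivity relation does not change connectivity. -/
theorem reachable_contract {Y Z : Type*} (T G₁ G₂ : SimpleGraph Z) (hT : T = G₁ ⊔ G₂)
    (φ : Y → Z) (H : SimpleGraph Y)
    (h₁ : ∀ y y', G₁.Reachable (φ y) (φ y') → H.Reachable y y')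
    (h₂ : ∀ z w, G₂.Adj z w → ∃ y y', φ y = z ∧ φ y' = w ∧ H.Adj y y')
    (hH : ∀ y y', H.Adj y y' → T.Reachable (φ y) (φ y')) (y y' : Y) :
    T.Reachable (φ y) (φ y') ↔ H.Reachable y y' := by
  constructor
  · have key : ∀ w, T.Reachable (φ y) w → ∃ v, H.Reachable y v ∧ G₁.Reachable (φ v) w := by
      intro w h
      rw [reachable_iff_reflTransGen] at h
      induction h with
      | refl => exact ⟨y, .rfl, .rfl⟩
      | tail _ hbc ih =>
        obtain ⟨v, hv, hvb⟩ := ih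
        rw [hT, sup_adj] at hbc
        rcases hbc with hbc | hbc
        · exact ⟨v, hv, hvb.trans hbc.reachable⟩
        · obtain ⟨a, a', rfl, rfl, haa⟩ := h₂ _ _ hbc
          exact ⟨a', (hv.trans (h₁ _ _ hvb)).trans haa.reachable, .rfl⟩
    intro h
    obtain ⟨v, hv, hvw⟩ := key _ h
    exact hv.trans (h₁ _ _ hvw)
  · intro h
    rw [reachable_iff_reflTransGen] at h
    induction h with
    | refl => exact .rfl
    | tail _ hbc ih => exact ih.trans (hH _ _ hbc)

/-- The number of connected components of `G` all of whose vertices lie in `B`. -/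
noncomputable def numComponentsIn {X : Type*} (G : SimpleGraph X) (B : Set X) : ℕ :=
  Nat.card {C : G.ConnectedComponent // C.supp ⊆ B}

theorem supp_subset_iff {X : Type*} (G : SimpleGraph X) (B : Set X) (v : X) :
    (G.connectedComponentMk v).supp ⊆ B ↔ ∀ w, G.Reachable v w → w ∈ B :=
  ⟨fun h _ hw => h (ConnectedComponent.eq.2 hw.symm),
    fun h _ hw => h _ (ConnectedComponent.eq.1 hw).symm⟩

theorem numComponentsIn_eq_add {X Y Z : Type*} [Finite X] [Finite Y]
    (T : SimpleGraph Z) (K : SimpleGraph X) (H : SimpleGraph Y)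
    (φ : Y → Z) (ψ : X ↪ Z) (BX : Set X) (BY : Set Y)
    (hKT : K.map ψ ≤ T) (hψ : ψ '' BX = (Set.range φ)ᶜ) (hφ : Function.Injective φ)
    (hE : ∀ x ∈ BX, ∀ z, T.Adj (ψ x) z → ∃ x', ψ x' = z ∧ K.Adj x x')
    (hR : ∀ y y', T.Reachable (φ y) (φ y') ↔ H.Reachable y y') :
    T.numComponentsIn (φ '' BY ∪ ψ '' BX) = K.numComponentsIn BX + H.numComponentsIn BY := by
  have hKr : ∀ x x', K.Reachable x x' → T.Reachable (ψ x) (ψ x') := by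
    intro x x' h
    exact (h.map (Embedding.map ψ K).toHom).mono hKT
  have hcl : ∀ x, (∀ x', K.Reachable x x' → x' ∈ BX) → ∀ z, T.Reachable (ψ x) z →
      ∃ x', ψ x' = z ∧ K.Reachable x x' := by
    intro x hx z h
    rw [reachable_iff_reflTransGen] at h
    induction h with
    | refl => exact ⟨x, rfl, .rfl⟩
    | tail _ hbc ih =>
      obtain ⟨b, rfl, hb⟩ := ih
      obtain ⟨c, rfl, hc⟩ := hE b (hx b hb) _ hbc
      exact ⟨c, rfl, hb.trans hc.reachable⟩
  have hdisj : ∀ x ∈ BX, ∀ y, ψ x ≠ φ y := by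
    intro x hx y h
    have : ψ x ∈ (Set.range φ)ᶜ := hψ ▸ Set.mem_image_of_mem _ hx
    exact this ⟨y, h.symm⟩
  have hmemX := supp_subset_iff K
  have hmemY := supp_subset_iff H
  have hmemZ := supp_subset_iff T
  let F : {C : K.ConnectedComponent // C.supp ⊆ BX} ⊕ {C : H.ConnectedComponent // C.supp ⊆ BY} →
      T.ConnectedComponent :=
    Sum.elim (fun C => Quot.map ψ (fun a b => hKr a b) C.1)
      (fun C => Quot.map φ (fun a b => (hR a b).2) C.1)
  have hF : ∀ c, (F c).supp ⊆ φ '' BY ∪ ψ '' BX := by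
    rintro (⟨⟨x⟩, hC⟩ | ⟨⟨y⟩, hC⟩)
    · refine (hmemZ _ (ψ x)).2 fun z hz => Or.inr ?_
      have hC' := (hmemX _ x).1 hC
      obtain ⟨x', rfl, hx'⟩ := hcl x hC' z hz
      exact ⟨x', hC' _ hx', rfl⟩
    · refine (hmemZ _ (φ y)).2 fun z hz => ?_
      by_cases hz' : z ∈ Set.range φ
      · obtain ⟨y', rfl⟩ := hz'
        exact Or.inl ⟨y', (hmemY _ y).1 hC _ ((hR _ _).1 hz), rfl⟩
      · exact Or.inr (hψ ▸ hz')
  have hbij : Function.Bijective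
      (fun c => (⟨F c, hF c⟩ : {C : T.ConnectedComponent // C.supp ⊆ φ '' BY ∪ ψ '' BX})) := by
    constructor
    · intro c c' hcc
      have h := congrArg Subtype.val hcc
      rcases c with ⟨⟨x⟩, hC⟩ | ⟨⟨y⟩, hC⟩ <;> rcases c' with ⟨⟨x'⟩, hC'⟩ | ⟨⟨y'⟩, hC'⟩
      · have h' : T.Reachable (ψ x) (ψ x') := ConnectedComponent.eq.1 h
        obtain ⟨x'', hx, hxx⟩ := hcl x ((hmemX _ x).1 hC) _ h'
        obtain rfl := ψ.injective hx
        exact congrArg Sum.inl (Subtype.ext (ConnectedComponent.eq.2 hxx))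
      · have h' : T.Reachable (ψ x) (φ y') := ConnectedComponent.eq.1 h
        obtain ⟨x'', hx, hxx⟩ := hcl x ((hmemX _ x).1 hC) _ h'
        exact absurd hx (hdisj _ ((hmemX _ x).1 hC _ hxx) _)
      · have h' : T.Reachable (φ y) (ψ x') := ConnectedComponent.eq.1 h
        obtain ⟨x'', hx, hxx⟩ := hcl x' ((hmemX _ x').1 hC') _ h'.symm
        exact absurd hx (hdisj _ ((hmemX _ x').1 hC' _ hxx) _)
      · have h' : T.Reachable (φ y) (φ y') := ConnectedComponent.eq.1 h
        exact congrArg Sum.inr (Subtype.ext (ConnectedComponent.eq.2 ((hR _ _).1 h')))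
    · rintro ⟨⟨z⟩, hz⟩
      have hz' := (hmemZ _ z).1 hz
      by_cases h : ∃ y, T.Reachable z (φ y)
      · obtain ⟨y, hy⟩ := h
        refine ⟨Sum.inr ⟨H.connectedComponentMk y, (hmemY _ y).2 fun y' hy' => ?_⟩,
          Subtype.ext (ConnectedComponent.eq.2 hy.symm)⟩
        rcases hz' _ (hy.trans ((hR _ _).2 hy')) with ⟨y'', h1, h2⟩ | ⟨x, h1, h2⟩
        · rwa [← hφ h2]
        · exact absurd h2 (hdisj x h1 y')
      · have hin : ∀ w, T.Reachable z w → w ∈ ψ '' BX := by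
          intro w hw
          rw [hψ]
          rintro ⟨y, rfl⟩
          exact h ⟨y, hw⟩
        obtain ⟨x, hx, rfl⟩ := hin z .rfl
        refine ⟨Sum.inl ⟨K.connectedComponentMk x, (hmemX _ x).2 fun x' hx' => ?_⟩,
          Subtype.ext rfl⟩
        obtain ⟨x'', h1, h2⟩ := hin _ (hKr _ _ hx')
        rwa [← ψ.injective h2]
  have hfX : Finite K.ConnectedComponent := Quot.finite _
  have hfY : Finite H.ConnectedComponent := Quot.finite _
  rw [numComponentsIn, ← Nat.card_eq_of_bijective _ hbij, Nat.card_sum]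
  rfl

end SimpleGraph

/-! ### Brauer diagrams -/

/-- A Brauer diagram on two columns of vertices, each indexed by `V`: a graph in which every
vertex lies on exactly one edge. The summand `Sum.inl` of `V ⊕ V` is the left-hand column and
`Sum.inr` the right-hand column. The Brauer `n`-diagrams are the case that `V` has `n` elements. -/
@[ext]
structure BrauerDiagram (V : Type) where
  /-- the underlying graph -/
  graph : SimpleGraph (V ⊕ V)
  /-- every vertex is connected to exactly one other vertex -/
  existsUnique_adj : ∀ x, ∃! y, graph.Adj x y

namespace BrauerDiagram

open SimpleGraph

variable {V : Type}

/-- The left-hand and middle columns among the three columns (left, middle, right). -/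
def leftMiddle : V ⊕ V ↪ V ⊕ V ⊕ V :=
  ⟨Sum.map id Sum.inl, Function.injective_id.sumMap Sum.inl_injective⟩

/-- The middle and right-hand columns among the three columns (left, middle, right). -/
def middleRight : V ⊕ V ↪ V ⊕ V ⊕ V :=
  ⟨Sum.inr, Sum.inr_injective⟩

/-- The two outer columns among the three columns (left, middle, right). -/
def outer : V ⊕ V ↪ V ⊕ V ⊕ V :=
  ⟨Sum.map id Sum.inr, Function.injective_id.sumMap Sum.inr_injective⟩

/-- The middle column among the three columns (left, middle, right). -/
def middle : V → V ⊕ V ⊕ V := fun i => Sum.inr (Sum.inl i)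

/-- The graph on three columns of vertices obtained by placing the second diagram to the right of
the first one and identifying the right-hand column of the first diagram with the left-hand
column of the second one. -/
def stack (d₁ d₂ : BrauerDiagram V) : SimpleGraph (V ⊕ V ⊕ V) :=
  d₁.graph.map leftMiddle ⊔ d₂.graph.map middleRight

/-- The number of loops in the middle column: the number of connected components of the three
column graph that lie entirely within the middle column. Every vertex of the middle column lies on
an edge of either diagram, so all these components are loops. -/
noncomputable def loops (d₁ d₂ : BrauerDiagram V) : ℕ :=
  (stack d₁ d₂).numComponentsIn (Set.range middle)

/-- The vertex joined to `x` by the edge through `x`. -/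
noncomputable def partner (d : BrauerDiagram V) (x : V ⊕ V) : V ⊕ V :=
  (d.existsUnique_adj x).choose

theorem adj_iff (d : BrauerDiagram V) (x y : V ⊕ V) : d.graph.Adj x y ↔ d.partner x = y :=
  ⟨fun h => ((d.existsUnique_adj x).choose_spec.2 y h).symm,
    fun h => h ▸ (d.existsUnique_adj x).choose_spec.1⟩

theorem partner_partner (d : BrauerDiagram V) (x : V ⊕ V) : d.partner (d.partner x) = x :=
  (d.adj_iff _ _).1 ((d.adj_iff _ _).2 rfl).symm

theorem partner_ne (d : BrauerDiagram V) (x : V ⊕ V) : d.partner x ≠ x := fun h =>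
  ((d.adj_iff x x).2 h).ne rfl

/-- The partner map as a permutation. -/
noncomputable def perm (d : BrauerDiagram V) : Equiv.Perm (V ⊕ V) :=
  ⟨d.partner, d.partner, d.partner_partner, d.partner_partner⟩

theorem reachable_iff (d : BrauerDiagram V) (x y : V ⊕ V) :
    d.graph.Reachable x y ↔ x = y ∨ d.graph.Adj x y := by
  constructor
  · intro h
    rw [reachable_iff_reflTransGen] at h
    induction h with
    | refl => exact Or.inl rfl
    | tail _ hbc ih =>
      rcases ih with rfl | h
      · exact Or.inr hbc
      · exact Or.inl ((d.existsUnique_adj _).unique h.symm hbc)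
  · rintro (rfl | h)
    · exact .rfl
    · exact h.reachable

theorem viaEmbedding_fixed {X Z : Type*} (p : Equiv.Perm X) (f : X ↪ Z) (hp : ∀ x, p x ≠ x) (z : Z) :
    p.viaEmbedding f z = z ↔ z ∉ Set.range f := by
  constructor
  · rintro h ⟨x, rfl⟩
    rw [Equiv.Perm.viaEmbedding_apply] at h
    exact hp x (f.injective h)
  · exact Equiv.Perm.viaEmbedding_apply_of_notMem p f z

theorem viaEmbedding_invol {X Z : Type*} (p : Equiv.Perm X) (f : X ↪ Z) (hp : ∀ x, p (p x) = x)
    (z : Z) : p.viaEmbedding f (p.viaEmbedding f z) = z := by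
  by_cases h : z ∈ Set.range f
  · obtain ⟨x, rfl⟩ := h
    rw [Equiv.Perm.viaEmbedding_apply, Equiv.Perm.viaEmbedding_apply, hp]
  · rw [Equiv.Perm.viaEmbedding_apply_of_notMem p f z h,
      Equiv.Perm.viaEmbedding_apply_of_notMem p f z h]

theorem map_adj_iff {Z : Type*} (d : BrauerDiagram V) (f : V ⊕ V ↪ Z) (z w : Z) :
    (d.graph.map f).Adj z w ↔ z ≠ w ∧ d.perm.viaEmbedding f z = w := by
  constructor
  · intro h
    refine ⟨h.ne, ?_⟩
    obtain ⟨x, y, hxy, rfl, rfl⟩ := (map_adj f _ _ _).1 h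
    rw [Equiv.Perm.viaEmbedding_apply]
    exact congrArg f ((d.adj_iff x y).1 hxy)
  · rintro ⟨hne, h⟩
    by_cases hz : z ∈ Set.range f
    · obtain ⟨x, rfl⟩ := hz
      rw [Equiv.Perm.viaEmbedding_apply] at h
      exact (map_adj f _ _ _).2 ⟨x, d.partner x, (d.adj_iff _ _).2 rfl, rfl, h⟩
    · rw [Equiv.Perm.viaEmbedding_apply_of_notMem _ f z hz] at h
      exact absurd h hne

theorem exists_outer_iff (z : V ⊕ V ⊕ V) :
    z ∈ Set.range outer ↔ z ∉ Set.range leftMiddle ∨ z ∉ Set.range middleRight := by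
  rcases z with i | i | i <;> simp [outer, leftMiddle, middleRight]

theorem existsUnique_reachable [Finite V] (d₁ d₂ : BrauerDiagram V) (x : V ⊕ V) :
    ∃! y, x ≠ y ∧ (stack d₁ d₂).Reachable (outer x) (outer y) := by
  have hfix : ∀ z : V ⊕ V ⊕ V, (d₁.perm.viaEmbedding leftMiddle z = z ∨
      d₂.perm.viaEmbedding middleRight z = z) ↔ z ∈ Set.range outer := by
    intro z
    rw [exists_outer_iff, viaEmbedding_fixed _ _ d₁.partner_ne, viaEmbedding_fixed _ _ d₂.partner_ne]
  obtain ⟨y, ⟨hy, hr, hf⟩, hu⟩ := existsUnique_end (d₁.perm.viaEmbedding leftMiddle)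
    (d₂.perm.viaEmbedding middleRight) (viaEmbedding_invol _ _ d₁.partner_partner)
    (viaEmbedding_invol _ _ d₂.partner_partner)
    (by
      intro z h1 h2
      rw [viaEmbedding_fixed _ _ d₁.partner_ne] at h1
      rw [viaEmbedding_fixed _ _ d₂.partner_ne] at h2
      rcases z with i | i | i <;> simp [leftMiddle, middleRight] at h1 h2)
    (stack d₁ d₂)
    (by
      intro z w
      rw [stack, sup_adj, map_adj_iff, map_adj_iff, and_or_left])
    (outer x) ((hfix _).2 ⟨x, rfl⟩)
  obtain ⟨y, rfl⟩ := (hfix _).1 hf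
  refine ⟨y, ⟨fun h => hy (h ▸ rfl), hr⟩, fun y' hy' => outer.injective (hu (outer y') ?_)⟩
  exact ⟨fun h => hy'.1 (outer.injective h).symm, hy'.2, (hfix _).2 ⟨y', rfl⟩⟩

/-- The diagram underlying the product of two diagrams: two distinct vertices of the outer columns
are joined by an edge if there is a path between them in the three column graph. -/
instance [Finite V] : Mul (BrauerDiagram V) where
  mul d₁ d₂ :=
    { graph :=
        { Adj := fun x y => x ≠ y ∧ (stack d₁ d₂).Reachable (outer x) (outer y)
          symm := ⟨fun _ _ h => ⟨h.1.symm, h.2.symm⟩⟩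
          loopless := ⟨fun _ h => h.1 rfl⟩ }
      existsUnique_adj := existsUnique_reachable d₁ d₂ }

/-- The identity diagram, with edges the horizontal ones. -/
instance : One (BrauerDiagram V) where
  one :=
    { graph :=
        { Adj := fun x y => x.swap = y
          symm := ⟨fun x y h => by subst h; exact Sum.swap_swap x⟩
          loopless := ⟨fun x h => by rcases x with i | i <;> simp at h⟩ }
      existsUnique_adj := fun x => ⟨x.swap, rfl, fun _ h => Eq.symm h⟩ }

theorem mul_adj [Finite V] (d₁ d₂ : BrauerDiagram V) (x y : V ⊕ V) : (d₁ * d₂).graph.Adj x y ↔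
    x ≠ y ∧ (stack d₁ d₂).Reachable (outer x) (outer y) := Iff.rfl

theorem one_adj (x y : V ⊕ V) : (1 : BrauerDiagram V).graph.Adj x y ↔ x.swap = y := Iff.rfl

theorem ext_of_reachable {d d' : BrauerDiagram V}
    (h : ∀ x y, d.graph.Reachable x y ↔ d'.graph.Reachable x y) : d = d' := by
  refine BrauerDiagram.ext (SimpleGraph.ext ?_)
  have key : ∀ d : BrauerDiagram V, ∀ x y, d.graph.Adj x y ↔ x ≠ y ∧ d.graph.Reachable x y := by
    intro d x y
    rw [reachable_iff]
    exact ⟨fun h => ⟨h.ne, Or.inr h⟩, fun h => h.2.resolve_left h.1⟩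
  ext x y
  rw [key, key, h]

theorem mul_reachable [Finite V] (d₁ d₂ : BrauerDiagram V) (x y : V ⊕ V) :
    (d₁ * d₂).graph.Reachable x y ↔ (stack d₁ d₂).Reachable (outer x) (outer y) := by
  rw [reachable_iff, mul_adj]
  by_cases h : x = y
  · subst h; simp
  · simp [h]

theorem stack_adj_left {d₁ d₂ : BrauerDiagram V} {x y : V ⊕ V} (h : d₁.graph.Adj x y) :
    (stack d₁ d₂).Adj (leftMiddle x) (leftMiddle y) :=
  Or.inl ((map_adj_apply (f := leftMiddle)).2 h)

theorem stack_adj_right {d₁ d₂ : BrauerDiagram V} {x y : V ⊕ V} (h : d₂.graph.Adj x y) :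
    (stack d₁ d₂).Adj (middleRight x) (middleRight y) :=
  Or.inr ((map_adj_apply (f := middleRight)).2 h)

theorem stack_adj_elim {d₁ d₂ : BrauerDiagram V} {z w : V ⊕ V ⊕ V} (h : (stack d₁ d₂).Adj z w) :
    (∃ x y, d₁.graph.Adj x y ∧ leftMiddle x = z ∧ leftMiddle y = w) ∨
      ∃ x y, d₂.graph.Adj x y ∧ middleRight x = z ∧ middleRight y = w := by
  rcases h with h | h
  · exact Or.inl ((map_adj _ _ _ _).1 h)
  · exact Or.inr ((map_adj _ _ _ _).1 h)

/-! #### Unit laws -/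

theorem one_mul_aux [Finite V] (d : BrauerDiagram V) : 1 * d = d := by
  refine ext_of_reachable fun x y => ?_
  rw [mul_reachable]
  constructor
  · have key : ∀ z w, (stack 1 d).Reachable z w →
        d.graph.Reachable (Sum.elim Sum.inl id z) (Sum.elim Sum.inl id w) := by
      intro z w h
      rw [SimpleGraph.reachable_iff_reflTransGen] at h
      induction h with
      | refl => exact .rfl
      | tail _ hbc ih =>
        refine ih.trans ?_
        rcases stack_adj_elim hbc with ⟨a, b, hab, rfl, rfl⟩ | ⟨a, b, hab, rfl, rfl⟩
        · rw [one_adj] at hab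
          subst hab
          rcases a with i | i <;> exact .rfl
        · exact hab.reachable
    intro h
    have := key _ _ h
    rcases x with i | i <;> rcases y with j | j <;> exact this
  · intro h
    rcases (reachable_iff d _ _).1 h with rfl | h
    · exact .rfl
    · have h1 : ∀ x : V ⊕ V, (stack 1 d).Reachable (outer x) (middleRight x) := by
        rintro (i | i)
        · exact (stack_adj_left (x := Sum.inl i) (y := Sum.inr i) rfl).reachable
        · exact .rfl
      exact ((h1 x).trans (stack_adj_right h).reachable).trans (h1 y).symm

theorem mul_one_aux [Finite V] (d : BrauerDiagram V) : d * 1 = d := by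
  refine ext_of_reachable fun x y => ?_
  rw [mul_reachable]
  constructor
  · have key : ∀ z w, (stack d 1).Reachable z w →
        d.graph.Reachable (Sum.elim Sum.inl (Sum.elim Sum.inr Sum.inr) z)
          (Sum.elim Sum.inl (Sum.elim Sum.inr Sum.inr) w) := by
      intro z w h
      rw [SimpleGraph.reachable_iff_reflTransGen] at h
      induction h with
      | refl => exact .rfl
      | tail _ hbc ih =>
        refine ih.trans ?_
        rcases stack_adj_elim hbc with ⟨a, b, hab, rfl, rfl⟩ | ⟨a, b, hab, rfl, rfl⟩
        · have := hab.reachable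
          rcases a with i | i <;> rcases b with j | j <;> exact this
        · rw [one_adj] at hab
          subst hab
          rcases a with i | i <;> exact .rfl
    intro h
    have := key _ _ h
    rcases x with i | i <;> rcases y with j | j <;> exact this
  · intro h
    rcases (reachable_iff d _ _).1 h with rfl | h
    · exact .rfl
    · have h1 : ∀ x : V ⊕ V, (stack d 1).Reachable (outer x) (leftMiddle x) := by
        rintro (i | i)
        · exact .rfl
        · exact (stack_adj_right (x := Sum.inr i) (y := Sum.inl i) rfl).reachable
      exact ((h1 x).trans (stack_adj_left h).reachable).trans (h1 y).symm

theorem loops_eq_zero {d₁ d₂ : BrauerDiagram V}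
    (h : ∀ i, ∃ z, z ∉ Set.range (middle (V := V)) ∧ (stack d₁ d₂).Reachable (middle i) z) :
    loops d₁ d₂ = 0 := by
  rw [loops, numComponentsIn, Nat.card_eq_zero]
  refine Or.inl ⟨?_⟩
  rintro ⟨⟨z⟩, hz⟩
  have hz' := (supp_subset_iff _ _ z).1 hz
  obtain ⟨i, rfl⟩ := hz' z .rfl
  obtain ⟨w, hw, hr⟩ := h i
  exact hw (hz' w hr)

theorem loops_one_left (d : BrauerDiagram V) : loops 1 d = 0 :=
  loops_eq_zero fun i => ⟨Sum.inl i, by simp [middle],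
    (stack_adj_left (x := Sum.inr i) (y := Sum.inl i) rfl).reachable⟩

theorem loops_one_right (d : BrauerDiagram V) : loops d 1 = 0 :=
  loops_eq_zero fun i => ⟨Sum.inr (Sum.inr i), by simp [middle],
    (stack_adj_right (x := Sum.inl i) (y := Sum.inr i) rfl).reachable⟩

/-! #### Associativity -/

/-- Columns 1, 2 of four. -/
def cols12 : V ⊕ V ↪ V ⊕ V ⊕ V ⊕ V :=
  ⟨Sum.map id Sum.inl, Function.injective_id.sumMap Sum.inl_injective⟩

/-- Columns 2, 3 of four. -/
def cols23 : V ⊕ V ↪ V ⊕ V ⊕ V ⊕ V :=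
  ⟨Sum.inr ∘ Sum.map id Sum.inl,
    Sum.inr_injective.comp (Function.injective_id.sumMap Sum.inl_injective)⟩

/-- Columns 3, 4 of four. -/
def cols34 : V ⊕ V ↪ V ⊕ V ⊕ V ⊕ V :=
  ⟨Sum.inr ∘ Sum.inr, Sum.inr_injective.comp Sum.inr_injective⟩

/-- Three diagrams side by side, as a graph on four columns. -/
def stack₃ (d₁ d₂ d₃ : BrauerDiagram V) : SimpleGraph (V ⊕ V ⊕ V ⊕ V) :=
  d₁.graph.map cols12 ⊔ d₂.graph.map cols23 ⊔ d₃.graph.map cols34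

/-- Columns 1, 2, 3 of four. -/
def cols123 : V ⊕ V ⊕ V ↪ V ⊕ V ⊕ V ⊕ V :=
  ⟨Sum.map id (Sum.map id Sum.inl), Function.injective_id.sumMap
    (Function.injective_id.sumMap Sum.inl_injective)⟩

/-- Columns 2, 3, 4 of four. -/
def cols234 : V ⊕ V ⊕ V ↪ V ⊕ V ⊕ V ⊕ V := ⟨Sum.inr, Sum.inr_injective⟩

/-- Columns 1, 3, 4 of four. -/
def cols134 : V ⊕ V ⊕ V → V ⊕ V ⊕ V ⊕ V := Sum.map id Sum.inr

/-- Columns 1, 2, 4 of four. -/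
def cols124 : V ⊕ V ⊕ V → V ⊕ V ⊕ V ⊕ V := Sum.map id (Sum.map id Sum.inr)

theorem stack_map (d₁ d₂ : BrauerDiagram V) (f : V ⊕ V ⊕ V ↪ V ⊕ V ⊕ V ⊕ V) :
    (stack d₁ d₂).map f = d₁.graph.map (f ∘ leftMiddle) ⊔ d₂.graph.map (f ∘ middleRight) := by
  rw [← map_map, ← map_map]
  ext z w
  rw [sup_adj]
  simp only [stack, map_adj, sup_adj]
  grind

theorem stack₃_eq_left (d₁ d₂ d₃ : BrauerDiagram V) : stack₃ d₁ d₂ d₃ =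
    (stack d₁ d₂).map cols123 ⊔ d₃.graph.map cols34 := by
  rw [stack_map, stack₃]
  congr 3
  all_goals
    funext x
    rcases x with i | i <;> rfl

theorem stack₃_eq_right (d₁ d₂ d₃ : BrauerDiagram V) : stack₃ d₁ d₂ d₃ =
    (stack d₂ d₃).map cols234 ⊔ d₁.graph.map cols12 := by
  rw [stack_map, stack₃, sup_assoc, sup_comm]
  rfl

theorem stack₃_reachable_left [Finite V] (d₁ d₂ d₃ : BrauerDiagram V) (y y' : V ⊕ V ⊕ V) :
    (stack₃ d₁ d₂ d₃).Reachable (cols134 y) (cols134 y') ↔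
      (stack (d₁ * d₂) d₃).Reachable y y' := by
  refine reachable_contract _ _ _ (stack₃_eq_left d₁ d₂ d₃) cols134 _ ?_ ?_ ?_ y y'
  · intro y y' h
    rcases Reachable.of_map _ _ h with h | ⟨a, b, ha, hb, hr⟩
    · obtain rfl : y = y' := by
        rcases y with i | i | i <;> rcases y' with j | j | j <;>
          simp [cols134] at h ⊢ <;> exact h
      exact .rfl
    · obtain ⟨x, rfl, rfl⟩ : ∃ x, a = outer x ∧ y = leftMiddle x := by
        rcases a with i | i | i <;> rcases y with j | j | j <;>
          simp [cols134, cols123, outer, leftMiddle] at ha ⊢ <;> first | exact ha | exact ha.symm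
      obtain ⟨x', rfl, rfl⟩ : ∃ x, b = outer x ∧ y' = leftMiddle x := by
        rcases b with i | i | i <;> rcases y' with j | j | j <;>
          simp [cols134, cols123, outer, leftMiddle] at hb ⊢ <;> first | exact hb | exact hb.symm
      have := (mul_reachable d₁ d₂ x x').2 hr
      rcases (reachable_iff _ _ _).1 this with rfl | h'
      · exact .rfl
      · exact (stack_adj_left h').reachable
  · intro z w h
    obtain ⟨a, b, hab, rfl, rfl⟩ := (map_adj _ _ _ _).1 h
    exact ⟨middleRight a, middleRight b, rfl, rfl, stack_adj_right hab⟩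
  · intro y y' h
    rw [stack₃_eq_left]
    rcases stack_adj_elim h with ⟨a, b, hab, rfl, rfl⟩ | ⟨a, b, hab, rfl, rfl⟩
    · have h1 := (mul_adj d₁ d₂ a b).1 hab
      have h2 := (h1.2.map (Embedding.map cols123 (stack d₁ d₂)).toHom).mono
        (le_sup_left (b := d₃.graph.map cols34))
      rcases a with i | i <;> rcases b with j | j <;> exact h2
    · exact Adj.reachable (Or.inr ((map_adj _ _ _ _).2 ⟨a, b, hab, rfl, rfl⟩))

theorem stack₃_reachable_right [Finite V] (d₁ d₂ d₃ : BrauerDiagram V) (y y' : V ⊕ V ⊕ V) :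
    (stack₃ d₁ d₂ d₃).Reachable (cols124 y) (cols124 y') ↔
      (stack d₁ (d₂ * d₃)).Reachable y y' := by
  refine reachable_contract _ _ _ (stack₃_eq_right d₁ d₂ d₃) cols124 _ ?_ ?_ ?_ y y'
  · intro y y' h
    rcases Reachable.of_map _ _ h with h | ⟨a, b, ha, hb, hr⟩
    · obtain rfl : y = y' := by
        rcases y with i | i | i <;> rcases y' with j | j | j <;>
          simp [cols124] at h ⊢ <;> exact h
      exact .rfl
    · obtain ⟨x, rfl, rfl⟩ : ∃ x, a = outer x ∧ y = middleRight x := by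
        rcases a with i | i | i <;> rcases y with j | j | j <;>
          simp [cols124, cols234, outer, middleRight] at ha ⊢ <;> exact ha
      obtain ⟨x', rfl, rfl⟩ : ∃ x, b = outer x ∧ y' = middleRight x := by
        rcases b with i | i | i <;> rcases y' with j | j | j <;>
          simp [cols124, cols234, outer, middleRight] at hb ⊢ <;> exact hb
      have := (mul_reachable d₂ d₃ x x').2 hr
      rcases (reachable_iff _ _ _).1 this with rfl | h'
      · exact .rfl
      · exact (stack_adj_right h').reachable
  · intro z w h
    obtain ⟨a, b, hab, rfl, rfl⟩ := (map_adj _ _ _ _).1 h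
    refine ⟨leftMiddle a, leftMiddle b, ?_, ?_, stack_adj_left hab⟩
    · rcases a with i | i <;> rfl
    · rcases b with i | i <;> rfl
  · intro y y' h
    rw [stack₃_eq_right]
    rcases stack_adj_elim h with ⟨a, b, hab, rfl, rfl⟩ | ⟨a, b, hab, rfl, rfl⟩
    · refine Adj.reachable (Or.inr ((map_adj _ _ _ _).2 ⟨a, b, hab, ?_, ?_⟩))
      · rcases a with i | i <;> rfl
      · rcases b with i | i <;> rfl
    · have h1 := (mul_adj d₂ d₃ a b).1 hab
      have h2 := (h1.2.map (Embedding.map cols234 (stack d₂ d₃)).toHom).mono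
        (le_sup_left (b := d₁.graph.map cols12))
      rcases a with i | i <;> rcases b with j | j <;> exact h2

theorem cols134_outer (x : V ⊕ V) : cols134 (outer x) = cols124 (outer x) := by
  rcases x with i | i <;> rfl

theorem mul_assoc_aux [Finite V] (d₁ d₂ d₃ : BrauerDiagram V) :
    d₁ * d₂ * d₃ = d₁ * (d₂ * d₃) := by
  refine ext_of_reachable fun x y => ?_
  rw [mul_reachable, mul_reachable, ← stack₃_reachable_left, ← stack₃_reachable_right,
    cols134_outer, cols134_outer]

theorem loops_assoc [Finite V] (d₁ d₂ d₃ : BrauerDiagram V) :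
    loops d₁ d₂ + loops (d₁ * d₂) d₃ = loops d₂ d₃ + loops d₁ (d₂ * d₃) := by
  have hl := numComponentsIn_eq_add (stack₃ d₁ d₂ d₃) (stack d₁ d₂) (stack (d₁ * d₂) d₃)
    cols134 cols123 (Set.range middle) (Set.range middle)
    (by rw [stack₃_eq_left]; exact le_sup_left)
    (by ext (i | i | i | i) <;> simp [cols134, cols123, middle])
    (Function.injective_id.sumMap Sum.inr_injective)
    (by
      rintro _ ⟨i, rfl⟩ z hz
      rw [stack₃_eq_left] at hz
      rcases hz with hz | hz
      · obtain ⟨a, b, hab, ha, rfl⟩ := (map_adj _ _ _ _).1 hz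
        obtain rfl := cols123.injective ha
        exact ⟨b, rfl, hab⟩
      · obtain ⟨a, b, hab, ha, rfl⟩ := (map_adj _ _ _ _).1 hz
        simp [cols123, cols34, middle] at ha)
    (stack₃_reachable_left d₁ d₂ d₃)
  have hr := numComponentsIn_eq_add (stack₃ d₁ d₂ d₃) (stack d₂ d₃) (stack d₁ (d₂ * d₃))
    cols124 cols234 (Set.range middle) (Set.range middle)
    (by rw [stack₃_eq_right]; exact le_sup_left)
    (by ext (i | i | i | i) <;> simp [cols124, cols234, middle])
    (Function.injective_id.sumMap (Function.injective_id.sumMap Sum.inr_injective))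
    (by
      rintro _ ⟨i, rfl⟩ z hz
      rw [stack₃_eq_right] at hz
      rcases hz with hz | hz
      · obtain ⟨a, b, hab, ha, rfl⟩ := (map_adj _ _ _ _).1 hz
        obtain rfl := cols234.injective ha
        exact ⟨b, rfl, hab⟩
      · obtain ⟨a, b, hab, ha, rfl⟩ := (map_adj _ _ _ _).1 hz
        rcases a with j | j <;> simp [cols234, cols12, middle] at ha)
    (stack₃_reachable_right d₁ d₂ d₃)
  rw [loops, loops, loops, loops, ← hl, ← hr]
  congr 1
  ext (i | i | i | i) <;> simp [cols134, cols123, cols124, cols234, middle]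

instance [Finite V] : Monoid (BrauerDiagram V) where
  mul_assoc := mul_assoc_aux
  one_mul := one_mul_aux
  mul_one := mul_one_aux

/-! #### Permutation diagrams -/

/-- A permutation diagram: a diagram with the maximal number of propagating edges, that is, every
vertex of the left-hand column lies on an edge to the right-hand column. -/
def IsPermutation (d : BrauerDiagram V) : Prop :=
  ∀ i, ∃ j, d.graph.Adj (Sum.inl i) (Sum.inr j)

theorem isPermutation_iff_left (d : BrauerDiagram V) :
    d.IsPermutation ↔ ∀ i j, ¬ d.graph.Adj (Sum.inl i) (Sum.inl j) := by
  constructor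
  · intro h i j hij
    obtain ⟨l, hl⟩ := h i
    exact Sum.inl_ne_inr ((d.existsUnique_adj _).unique hij hl)
  · intro h i
    obtain ⟨y, hy, -⟩ := d.existsUnique_adj (Sum.inl i)
    rcases y with j | j
    · exact absurd hy (h i j)
    · exact ⟨j, hy⟩

theorem isPermutation_iff_exists_right [Finite V] (d : BrauerDiagram V) :
    d.IsPermutation ↔ ∀ j, ∃ i, d.graph.Adj (Sum.inl i) (Sum.inr j) := by
  constructor
  · intro h
    choose f hf using h
    have hinj : Function.Injective f := by
      intro i i' hii
      have h1 := hf i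
      rw [hii] at h1
      exact Sum.inl_injective ((d.existsUnique_adj _).unique h1.symm (hf i').symm)
    intro j
    obtain ⟨i, rfl⟩ := Finite.surjective_of_injective hinj j
    exact ⟨i, hf i⟩
  · intro h
    choose f hf using h
    have hinj : Function.Injective f := by
      intro i i' hii
      have h1 := hf i
      rw [hii] at h1
      exact Sum.inr_injective ((d.existsUnique_adj _).unique h1 (hf i'))
    intro j
    obtain ⟨i, rfl⟩ := Finite.surjective_of_injective hinj j
    exact ⟨i, hf i⟩

theorem isPermutation_iff_right [Finite V] (d : BrauerDiagram V) :
    d.IsPermutation ↔ ∀ i j, ¬ d.graph.Adj (Sum.inr i) (Sum.inr j) := by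
  rw [isPermutation_iff_exists_right]
  constructor
  · intro h i j hij
    obtain ⟨l, hl⟩ := h i
    exact Sum.inr_ne_inl ((d.existsUnique_adj _).unique hij hl.symm)
  · intro h i
    obtain ⟨y, hy, -⟩ := d.existsUnique_adj (Sum.inr i)
    rcases y with j | j
    · exact ⟨j, hy.symm⟩
    · exact absurd hy (h i j)

theorem isPermutation_one : (1 : BrauerDiagram V).IsPermutation := fun i => ⟨i, rfl⟩

theorem isPermutation_mul_iff [Finite V] (d₁ d₂ : BrauerDiagram V) :
    (d₁ * d₂).IsPermutation ↔ d₁.IsPermutation ∧ d₂.IsPermutation := by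
  constructor
  · intro h
    constructor
    · rw [isPermutation_iff_left] at h ⊢
      intro i j hij
      exact h i j ⟨hij.ne, (stack_adj_left hij).reachable⟩
    · rw [isPermutation_iff_right] at h ⊢
      intro i j hij
      exact h i j ⟨hij.ne, (stack_adj_right hij).reachable⟩
  · rintro ⟨h₁, h₂⟩ i
    obtain ⟨j, hj⟩ := h₁ i
    obtain ⟨l, hl⟩ := h₂ j
    exact ⟨l, Sum.inl_ne_inr, (stack_adj_left hj).reachable.trans (stack_adj_right hl).reachable⟩

theorem IsPermutation.loops_eq_zero [Finite V] {d₁ : BrauerDiagram V} (h : d₁.IsPermutation)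
    (d₂ : BrauerDiagram V) : loops d₁ d₂ = 0 := by
  rw [isPermutation_iff_exists_right] at h
  refine BrauerDiagram.loops_eq_zero fun i => ?_
  obtain ⟨j, hj⟩ := h i
  exact ⟨Sum.inl j, by simp [middle], (stack_adj_left hj.symm).reachable⟩

/-! #### Walled diagrams -/

/-- Walled Brauer diagrams: the vertices of either column are divided into the first `r` of them,
`Sum.inl i`, and the last `s` of them, `Sum.inr j`. Propagating edges do not cross the wall, and
non-propagating edges in either column do cross it. -/
structure IsWalled {r s : ℕ} (d : BrauerDiagram (Fin r ⊕ Fin s)) : Prop where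
  propagating : ∀ i j, d.graph.Adj (Sum.inl i) (Sum.inr j) → (i.isLeft ↔ j.isLeft)
  left : ∀ i j, d.graph.Adj (Sum.inl i) (Sum.inl j) → (i.isLeft ↔ j.isRight)
  right : ∀ i j, d.graph.Adj (Sum.inr i) (Sum.inr j) → (i.isLeft ↔ j.isRight)

/-- The side of the wall as a sign. -/
def side {r s : ℕ} (i : Fin r ⊕ Fin s) : ℤ := Sum.elim 1 (-1) i

theorem side_sq {r s : ℕ} (i : Fin r ⊕ Fin s) : side i = 1 ∨ side i = -1 := by
  rcases i with i | i <;> simp [side]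

/-- The side of the wall as a sign, with the opposite sign in the right-hand column. -/
def side₂ {r s : ℕ} : (Fin r ⊕ Fin s) ⊕ (Fin r ⊕ Fin s) → ℤ := Sum.elim side (fun i => -side i)

theorem isWalled_iff {r s : ℕ} (d : BrauerDiagram (Fin r ⊕ Fin s)) :
    d.IsWalled ↔ ∀ x y, d.graph.Adj x y → side₂ x + side₂ y = 0 := by
  constructor
  · intro h x y hxy
    rcases x with i | i <;> rcases y with j | j
    · have := h.left i j hxy
      rcases i with i | i <;> rcases j with j | j <;> simp_all [side, side₂]
    · have := h.propagating i j hxy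
      rcases i with i | i <;> rcases j with j | j <;> simp_all [side, side₂]
    · have := h.propagating j i hxy.symm
      rcases i with i | i <;> rcases j with j | j <;> simp_all [side, side₂]
    · have := h.right i j hxy
      rcases i with i | i <;> rcases j with j | j <;> simp_all [side, side₂]
  · intro h
    refine ⟨fun i j hij => ?_, fun i j hij => ?_, fun i j hij => ?_⟩ <;>
    · have := h _ _ hij
      rcases i with i | i <;> rcases j with j | j <;> simp_all [side, side₂]

theorem isWalled_one {r s : ℕ} : (1 : BrauerDiagram (Fin r ⊕ Fin s)).IsWalled := by
  rw [isWalled_iff]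
  rintro (i | i) _ rfl <;> simp [side₂]

open Classical in
theorem IsWalled.mul {r s : ℕ} {d₁ d₂ : BrauerDiagram (Fin r ⊕ Fin s)}
    (h₁ : d₁.IsWalled) (h₂ : d₂.IsWalled) : (d₁ * d₂).IsWalled := by
  rw [isWalled_iff] at h₁ h₂ ⊢
  intro x y hxy
  -- sum the signs over the component of `x`, along the edges of either diagram
  let P : _ → Prop := fun z => (stack d₁ d₂).Reachable (outer x) z
  have hsum₁ : ∑ z, (if P (leftMiddle z) then side₂ z else 0) = 0 := by
    refine Finset.sum_involution (fun z _ => d₁.partner z) ?_ ?_ (fun _ _ => Finset.mem_univ _)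
      (fun z _ => d₁.partner_partner z)
    · intro z _
      have hadj := (d₁.adj_iff z _).2 rfl
      have hP : P (leftMiddle (d₁.partner z)) ↔ P (leftMiddle z) :=
        ⟨fun h => h.trans (stack_adj_left hadj).reachable.symm,
          fun h => h.trans (stack_adj_left hadj).reachable⟩
      by_cases h : P (leftMiddle z)
      · simp only [hP, h, if_true]
        exact h₁ _ _ hadj
      · simp [hP, h]
    · exact fun z _ _ => d₁.partner_ne z
  have hsum₂ : ∑ z, (if P (middleRight z) then side₂ z else 0) = 0 := by
    refine Finset.sum_involution (fun z _ => d₂.partner z) ?_ ?_ (fun _ _ => Finset.mem_univ _)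
      (fun z _ => d₂.partner_partner z)
    · intro z _
      have hadj := (d₂.adj_iff z _).2 rfl
      have hP : P (middleRight (d₂.partner z)) ↔ P (middleRight z) :=
        ⟨fun h => h.trans (stack_adj_right hadj).reachable.symm,
          fun h => h.trans (stack_adj_right hadj).reachable⟩
      by_cases h : P (middleRight z)
      · simp only [hP, h, if_true]
        exact h₂ _ _ hadj
      · simp [hP, h]
    · exact fun z _ _ => d₂.partner_ne z
  have hsum : ∑ z, (if P (outer z) then side₂ z else 0) = 0 := by
    rw [Fintype.sum_sum_type] at hsum₁ hsum₂ ⊢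
    have h3 : ∀ i, (if P (leftMiddle (Sum.inr i)) then side₂ (Sum.inr i) else 0) =
        - (if P (middleRight (Sum.inl i)) then side₂ (Sum.inl i) else 0 : ℤ) := by
      intro i
      have : (leftMiddle (Sum.inr i) : _ ⊕ _ ⊕ _) = middleRight (Sum.inl i) := rfl
      rw [this]
      split_ifs <;> simp [side₂]
    rw [Finset.sum_congr rfl fun i _ => h3 i, Finset.sum_neg_distrib] at hsum₁
    have h4 : ∀ i : Fin r ⊕ Fin s,
      (outer (Sum.inl i) : _ ⊕ _ ⊕ _) = leftMiddle (Sum.inl i) := fun _ => rfl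
    have h5 : ∀ i : Fin r ⊕ Fin s,
      (outer (Sum.inr i) : _ ⊕ _ ⊕ _) = middleRight (Sum.inr i) := fun _ => rfl
    simp only [h4, h5]
    linarith
  rw [← hsum, ← Finset.sum_filter]
  have hset : Finset.univ.filter (fun z => P (outer z)) = {x, y} := by
    ext z
    simp only [Finset.mem_filter, Finset.mem_univ, true_and, Finset.mem_insert,
      Finset.mem_singleton]
    constructor
    · intro hz
      by_cases hzx : z = x
      · exact Or.inl hzx
      · exact Or.inr (((d₁ * d₂).existsUnique_adj x).unique ⟨Ne.symm hzx, hz⟩ hxy)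
    · rintro (rfl | rfl)
      · exact .rfl
      · exact hxy.2
  rw [hset, Finset.sum_pair hxy.ne]

end BrauerDiagram

/-! ### Brauer algebras -/

/-- The Brauer algebra with parameter `δ` on columns of vertices indexed by `V`: the free
`k`-module on the Brauer diagrams. -/
def BrauerAlgebra (k : Type u) [CommRing k] (V : Type) (_δ : k) : Type u := BrauerDiagram V →₀ k

namespace BrauerAlgebra

noncomputable section

open BrauerDiagram

variable {k : Type u} [CommRing k] {V : Type} {δ : k}

instance : AddCommGroup (BrauerAlgebra k V δ) := inferInstanceAs (AddCommGroup (_ →₀ k))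

instance : Module k (BrauerAlgebra k V δ) := inferInstanceAs (Module k (_ →₀ k))

/-- The basis of the Brauer algebra given by the diagrams. -/
def basis (k : Type u) [CommRing k] (V : Type) (δ : k) :
    Module.Basis (BrauerDiagram V) k (BrauerAlgebra k V δ) :=
  Finsupp.basisSingleOne

variable (δ) in
/-- A diagram as an element of the Brauer algebra. -/
def of (d : BrauerDiagram V) : BrauerAlgebra k V δ := basis k V δ d

theorem hom_ext {M : Type*} [AddCommMonoid M] [Module k M] {f g : BrauerAlgebra k V δ →ₗ[k] M}
    (h : ∀ d, f (of δ d) = g (of δ d)) : f = g :=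
  (basis k V δ).ext h

instance : One (BrauerAlgebra k V δ) := ⟨of δ 1⟩

theorem one_def : (1 : BrauerAlgebra k V δ) = of δ 1 := rfl

variable [Finite V]

variable (k V δ) in
/-- The multiplication as a bilinear map: the product of the diagrams `d₁` and `d₂` is
`δ ^ α` times the diagram `d₁ * d₂`, where `α` is the number of loops in the middle column. -/
def mulHom : BrauerAlgebra k V δ →ₗ[k] BrauerAlgebra k V δ →ₗ[k] BrauerAlgebra k V δ :=
  (basis k V δ).constr k fun d₁ => (basis k V δ).constr k fun d₂ =>
    δ ^ loops d₁ d₂ • of δ (d₁ * d₂)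

instance : Mul (BrauerAlgebra k V δ) := ⟨fun a b => mulHom k V δ a b⟩

theorem mul_def (a b : BrauerAlgebra k V δ) : a * b = mulHom k V δ a b := rfl

theorem mulHom_of (d₁ d₂ : BrauerDiagram V) :
    mulHom k V δ (of δ d₁) (of δ d₂) = δ ^ loops d₁ d₂ • of δ (d₁ * d₂) := by
  simp [mulHom, of]

/-- The product of two diagrams in the Brauer algebra. -/
theorem of_mul_of (d₁ d₂ : BrauerDiagram V) :
    (of δ d₁ : BrauerAlgebra k V δ) * of δ d₂ = δ ^ loops d₁ d₂ • of δ (d₁ * d₂) :=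
  mulHom_of d₁ d₂

theorem mul_assoc_aux (a b c : BrauerAlgebra k V δ) : a * b * c = a * (b * c) := by
  have h : (mulHom k V δ).compr₂ (mulHom k V δ) =
      (LinearMap.llcomp k _ _ _).flip (mulHom k V δ) ∘ₗ
        (LinearMap.llcomp k _ _ _ ∘ₗ mulHom k V δ) := by
    refine hom_ext fun d₁ => hom_ext fun d₂ => hom_ext fun d₃ => ?_
    simp only [LinearMap.compr₂_apply, LinearMap.comp_apply, LinearMap.flip_apply,
      LinearMap.llcomp_apply, mulHom_of, map_smul, LinearMap.smul_apply, smul_smul, ← pow_add,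
      loops_assoc, mul_assoc]
  exact LinearMap.congr_fun (LinearMap.congr_fun (LinearMap.congr_fun h a) b) c

theorem one_mul_aux (a : BrauerAlgebra k V δ) : 1 * a = a := by
  have h : mulHom k V δ (of δ 1) = LinearMap.id :=
    hom_ext fun d => by simp [mulHom_of, loops_one_left]
  exact LinearMap.congr_fun h a

theorem mul_one_aux (a : BrauerAlgebra k V δ) : a * 1 = a := by
  have h : (mulHom k V δ).flip (of δ 1) = LinearMap.id :=
    hom_ext fun d => by simp [mulHom_of, loops_one_right]
  exact LinearMap.congr_fun h a

instance : Ring (BrauerAlgebra k V δ) :=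
  { (inferInstance : AddCommGroup (BrauerAlgebra k V δ)),
    (inferInstance : Mul (BrauerAlgebra k V δ)),
    (inferInstance : One (BrauerAlgebra k V δ)) with
    left_distrib := fun a b c => map_add (mulHom k V δ a) b c
    right_distrib := fun a b c => LinearMap.map_add₂ (mulHom k V δ) a b c
    zero_mul := fun a => LinearMap.map_zero₂ (mulHom k V δ) a
    mul_zero := fun a => map_zero (mulHom k V δ a)
    mul_assoc := mul_assoc_aux
    one_mul := one_mul_aux
    mul_one := mul_one_aux }

instance : Algebra k (BrauerAlgebra k V δ) :=
  Algebra.ofModule (fun c a b => LinearMap.map_smul₂ (mulHom k V δ) c a b)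
    (fun c a b => map_smul (mulHom k V δ a) c b)

open Classical in
variable (k V δ) in
/-- The augmentation of the Brauer algebra: it sends the permutation diagrams to `1` and all other
diagrams to `0`. -/
def augmentation : BrauerAlgebra k V δ →ₐ[k] k :=
  AlgHom.ofLinearMap ((basis k V δ).constr k fun d => if d.IsPermutation then 1 else 0)
    (by
      rw [one_def, of, Module.Basis.constr_basis, if_pos isPermutation_one])
    (by
      set f : BrauerAlgebra k V δ →ₗ[k] k :=
        (basis k V δ).constr k fun d => if d.IsPermutation then 1 else 0 with hf
      have hof : ∀ d, f (of δ d) = if d.IsPermutation then 1 else 0 := fun d => by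
        rw [hf, of, Module.Basis.constr_basis]
      have h : (mulHom k V δ).compr₂ f = (LinearMap.mul k k).compl₁₂ f f := by
        refine hom_ext fun d₁ => hom_ext fun d₂ => ?_
        simp only [LinearMap.compr₂_apply, LinearMap.compl₁₂_apply, mulHom_of, map_smul, hof,
          LinearMap.mul_apply', isPermutation_mul_iff]
        by_cases h₁ : d₁.IsPermutation
        · simp [h₁, h₁.loops_eq_zero]
        · simp [h₁]
      exact fun a b => LinearMap.congr_fun (LinearMap.congr_fun h a) b)

end

end BrauerAlgebra

/-- The walled Brauer algebra with parameter `δ`: the subalgebra of the Brauer algebra on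
`r + s` vertices in each column that is spanned by the walled Brauer diagrams. -/
noncomputable def walledBrauerAlgebra (k : Type u) [CommRing k] (r s : ℕ) (δ : k) :
    Subalgebra k (BrauerAlgebra k (Fin r ⊕ Fin s) δ) :=
  (Submodule.span k
    {a | ∃ d : BrauerDiagram (Fin r ⊕ Fin s), d.IsWalled ∧ a = BrauerAlgebra.of δ d}).toSubalgebra
    (Submodule.subset_span ⟨1, BrauerDiagram.isWalled_one, rfl⟩)
    (by
      intro a b ha hb
      have h := Submodule.mul_mem_mul ha hb
      rw [Submodule.span_mul_span] at h
      refine Submodule.span_le.2 ?_ h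
      rintro _ ⟨_, ⟨d₁, h₁, rfl⟩, _, ⟨d₂, h₂, rfl⟩, rfl⟩
      change BrauerAlgebra.of δ d₁ * BrauerAlgebra.of δ d₂ ∈ _
      rw [BrauerAlgebra.of_mul_of]
      exact Submodule.smul_mem _ _ (Submodule.subset_span ⟨_, h₁.mul h₂, rfl⟩))

/-- The augmentation of the walled Brauer algebra: it sends the permutation diagrams to `1` and
all other diagrams to `0`. -/
noncomputable def walledBrauerAugmentation (k : Type u) [CommRing k] (r s : ℕ) (δ : k) :
    walledBrauerAlgebra k r s δ →ₐ[k] k :=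
  (BrauerAlgebra.augmentation k (Fin r ⊕ Fin s) δ).comp (walledBrauerAlgebra k r s δ).val

/-! Write `A` for the walled Brauer algebra, `G` for Σ_r × Σ_s, and `I` for the span of the walled
diagrams that are not permutations. A product of diagrams is a permutation only if both factors are,
so `I` is a two-sided ideal. The quotient `A / I` is the group algebra `k[G]`, the projection is
split by the permutation diagrams, and the augmentation of `A` factors through it.

Let `P` be a projective resolution of the trivial left `A`-module. The complex `P / I P` consists of
projective `k[G]`-modules, its coinvariants are the tensor product of the trivial right module with
`P`, and its `G`-maps to `k` are the `A`-maps from `P` to the trivial module. Both isomorphisms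
therefore follow once `P / I P` is again a resolution of `k`, and for this it is enough that the
subcomplex `I P` is acyclic (`reductionResolution`).

To prove this, cover `I` by right ideals. A walled diagram that is not a permutation has an arc `e`
in its left-hand column, and the diagrams with that arc span a right ideal `J_e`. The intersections
are the spans `J_S` of the diagrams whose left-hand column contains every arc of `S`. All these
ideals are spanned by parts of one basis, so sums and intersections are unions and intersections of
sets of diagrams and distribute over each other. Over projective modules `N`, the assignment `J ↦ J
N` respects sums and intersections of right ideals, which gives a Mayer–Vietoris argument
(`AcyclicOn.sup`, `AcyclicOn.finset_sup`) reducing acyclicity of `I P` to that of `J_S P` for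
nonempty `S`.

If two arcs of `S` share a vertex, then `J_S = 0`. Otherwise, as `δ` is invertible, suitable
multiples of the diagrams with one arc in either column multiply to an idempotent `ε ∈ J_S` with `ε
a = a` for all `a ∈ J_S` (`exists_leftUnit`). Then `J_S P = ε P` is the image of `P` under an exact
functor, so its homology is `ε` times the trivial module, which vanishes because `ε` lies in `I`
(`acyclicOn_of_leftUnit`). -/

open CategoryTheory

/-! ### Acyclicity of right ideals on projective resolutions -/

/-! ### The subgroups `J N` for right ideals `J` -/

namespace AddSubgroup

variable {A : Type*} [Ring A]

/-- The additive subgroup `J N` of a left module `N`, for an additive subgroup `J` of the ring. -/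
def smulModule (J : AddSubgroup A) (N : Type*) [AddCommGroup N] [Module A N] : AddSubgroup N :=
  closure {x | ∃ a ∈ J, ∃ n : N, a • n = x}

variable {N N' : Type*} [AddCommGroup N] [Module A N] [AddCommGroup N'] [Module A N']

theorem smul_mem_smulModule {J : AddSubgroup A} {a : A} (ha : a ∈ J) (n : N) :
    a • n ∈ J.smulModule N :=
  subset_closure ⟨a, ha, n, rfl⟩

theorem smulModule_le {J : AddSubgroup A} {S : AddSubgroup N}
    (h : ∀ a ∈ J, ∀ n : N, a • n ∈ S) : J.smulModule N ≤ S := by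
  refine (closure_le S).2 ?_
  rintro _ ⟨a, ha, n, rfl⟩
  exact h a ha n

theorem smulModule_mono {J K : AddSubgroup A} (h : J ≤ K) : J.smulModule N ≤ K.smulModule N :=
  smulModule_le fun _ ha n => smul_mem_smulModule (h ha) n

theorem map_mem_smulModule {J : AddSubgroup A} (f : N →ₗ[A] N') {x : N}
    (hx : x ∈ J.smulModule N) : f x ∈ J.smulModule N' := by
  have : J.smulModule N ≤ (J.smulModule N').comap f.toAddMonoidHom :=
    smulModule_le fun a ha n => by
      simpa using smul_mem_smulModule ha (f n)
  exact this hx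

theorem smulModule_sup_le (J K : AddSubgroup A) :
    (J ⊔ K).smulModule N ≤ J.smulModule N ⊔ K.smulModule N := by
  refine smulModule_le fun a ha n => ?_
  obtain ⟨b, hb, c, hc, rfl⟩ := mem_sup.1 ha
  rw [add_smul]
  exact add_mem (mem_sup_left (smul_mem_smulModule hb n))
    (mem_sup_right (smul_mem_smulModule hc n))

/-- If `J` is a right ideal and `N` is a direct summand of a free module, then membership in `J N`
can be read off from the coordinates in the free module. -/
theorem mem_smulModule_iff {J : AddSubgroup A} (hJ : ∀ a ∈ J, ∀ b, a * b ∈ J)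
    {s : N →ₗ[A] N →₀ A} (hs : Function.LeftInverse (Finsupp.linearCombination A id) s) (x : N) :
    x ∈ J.smulModule N ↔ ∀ i, s x i ∈ J := by
  constructor
  · intro hx i
    -- The `i`-th coordinate of `a • n` is `a * s n i`, which stays in `J` because `J` is a right
    -- ideal.
    have : J.smulModule N ≤ J.comap ((Finsupp.lapply i ∘ₗ s).toAddMonoidHom) :=
      smulModule_le fun a ha n => by
        simpa using hJ a ha (s n i)
    exact this hx
  · intro h
    rw [← hs x, Finsupp.linearCombination_apply, Finsupp.sum]
    exact sum_mem fun i _ => smul_mem_smulModule (h i) _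

/-- This is where projectivity enters: for arbitrary `N` the intersection of `J N` and `K N` can be
larger. For a summand of a free module, membership is a condition on each coordinate, and
coordinatewise the claim is trivial. -/
theorem smulModule_inf_le [Module.Projective A N] {J K : AddSubgroup A}
    (hJ : ∀ a ∈ J, ∀ b, a * b ∈ J) (hK : ∀ a ∈ K, ∀ b, a * b ∈ K) :
    J.smulModule N ⊓ K.smulModule N ≤ (J ⊓ K).smulModule N := by
  obtain ⟨s, hs⟩ := Module.projective_def.1 (inferInstance : Module.Projective A N)
  intro x hx
  rw [mem_smulModule_iff (J := J ⊓ K) (fun a ha b => ⟨hJ a ha.1 b, hK a ha.2 b⟩) hs]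
  exact fun i => ⟨(mem_smulModule_iff hJ hs x).1 hx.1 i, (mem_smulModule_iff hK hs x).1 hx.2 i⟩

end AddSubgroup

/-! ### Mayer–Vietoris for the subcomplexes `J Q` -/

namespace ChainComplex

variable {A : Type u} [Ring A] (Q : ChainComplex (ModuleCat.{u} A) ℕ)

/-- The subcomplex `J Q` of a complex `Q` of left modules has vanishing homology. -/
def AcyclicOn (J : AddSubgroup A) : Prop :=
  ∀ n, ∀ x ∈ J.smulModule (Q.X n), (∀ m, Q.d n m x = 0) →
    ∃ y ∈ J.smulModule (Q.X (n + 1)), Q.d (n + 1) n y = x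

variable {Q}

/-- Mayer–Vietoris for the exact sequence `0 → (J ⊓ K) Q → J Q ⊕ K Q → (J ⊔ K) Q → 0`, carried out
on elements. If `y + z` is a cycle, then `d y = -d z` lies in `(J ⊓ K) Q`, hence equals `d w` for
some `w` there. Now `y - w` and `z + w` are cycles in `J Q` and `K Q`, and can be bounded
separately. -/
theorem AcyclicOn.sup [∀ n, Projective (Q.X n)] {J K : AddSubgroup A}
    (hJ : ∀ a ∈ J, ∀ b, a * b ∈ J) (hK : ∀ a ∈ K, ∀ b, a * b ∈ K)
    (h₁ : Q.AcyclicOn J) (h₂ : Q.AcyclicOn K) (h₃ : Q.AcyclicOn (J ⊓ K)) :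
    Q.AcyclicOn (J ⊔ K) := by
  intro n x hx hdx
  obtain ⟨y, hy, z, hz, rfl⟩ := AddSubgroup.mem_sup.1 (AddSubgroup.smulModule_sup_le J K hx)
  obtain ⟨w, hw, hdw⟩ : ∃ w ∈ (J ⊓ K).smulModule (Q.X n), ∀ m, Q.d n m w = Q.d n m y := by
    rcases n with - | n
    -- In degree zero every outgoing differential vanishes, so no correction is needed.
    · exact ⟨0, zero_mem _, fun m => by rw [Q.shape 0 m (by simp)]; rfl⟩
    · have hyz : Q.d (n + 1) n y = -Q.d (n + 1) n z := by
        have := hdx n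
        rw [map_add] at this
        exact eq_neg_of_add_eq_zero_left this
      have : Module.Projective A (Q.X n) :=
        (IsProjective.iff_projective (R := A) (Q.X n)).2 inferInstance
      have hmem : Q.d (n + 1) n y ∈ (J ⊓ K).smulModule (Q.X n) := by
        refine AddSubgroup.smulModule_inf_le hJ hK ⟨?_, ?_⟩
        · exact AddSubgroup.map_mem_smulModule _ hy
        · rw [hyz]
          exact (K.smulModule (Q.X n)).neg_mem (AddSubgroup.map_mem_smulModule _ hz)
      obtain ⟨w, hw, hdw⟩ := h₃ n _ hmem fun m => by
        rw [← ModuleCat.comp_apply, Q.d_comp_d]; rfl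
      refine ⟨w, hw, fun m => ?_⟩
      by_cases hm : m = n
      · subst hm; exact hdw
      · rw [Q.shape (n + 1) m (by simpa using hm)]; rfl
  obtain ⟨y', hy', hdy'⟩ := h₁ n (y - w)
    (sub_mem hy (AddSubgroup.smulModule_mono inf_le_left hw))
    fun m => by rw [map_sub, hdw, sub_self]
  obtain ⟨z', hz', hdz'⟩ := h₂ n (z + w)
    (add_mem hz (AddSubgroup.smulModule_mono inf_le_right hw))
    fun m => by rw [map_add, hdw, add_comm, ← map_add, hdx m]
  exact ⟨y' + z', add_mem (AddSubgroup.smulModule_mono le_sup_left hy')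
    (AddSubgroup.smulModule_mono le_sup_right hz'), by rw [map_add, hdy', hdz']; abel⟩

/-- A finite union of right ideals is acyclic on a complex of projective modules if all finite
intersections are. Here the right ideals are indexed by elements of a distributive lattice `α`. -/
theorem AcyclicOn.finset_sup [∀ n, Projective (Q.X n)] {α : Type*} [DistribLattice α] [OrderBot α]
    (J : α → AddSubgroup A) (hbot : J ⊥ = ⊥) (hsup : ∀ D E, J (D ⊔ E) = J D ⊔ J E)
    (hinf : ∀ D E, J (D ⊓ E) = J D ⊓ J E) (𝓕 : Set α) (h𝓕 : ∀ D ∈ 𝓕, ∀ E ∈ 𝓕, D ⊓ E ∈ 𝓕)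
    (hJ : ∀ D ∈ 𝓕, ∀ a ∈ J D, ∀ b, a * b ∈ J D) (hac : ∀ D ∈ 𝓕, Q.AcyclicOn (J D))
    {ι : Type*} (s : Finset ι) (f : ι → α) (hf : ∀ i ∈ s, f i ∈ 𝓕) :
    (∀ a ∈ J (s.sup f), ∀ b, a * b ∈ J (s.sup f)) ∧ Q.AcyclicOn (J (s.sup f)) := by
  classical
  induction s using Finset.induction_on generalizing f with
  | empty =>
    rw [Finset.sup_empty, hbot]
    refine ⟨fun a ha b => ?_, fun n x hx _ => ?_⟩
    · rw [AddSubgroup.mem_bot.1 ha, zero_mul]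
      exact zero_mem _
    · have h : (⊥ : AddSubgroup A).smulModule (Q.X n) ≤ ⊥ :=
        AddSubgroup.smulModule_le fun a ha n => by
          rw [AddSubgroup.mem_bot.1 ha, zero_smul]; exact zero_mem _
      exact ⟨0, zero_mem _, by rw [AddSubgroup.mem_bot.1 (h hx), map_zero]⟩
  | insert i s _ ih =>
    have hi := hf i (Finset.mem_insert_self _ _)
    obtain ⟨h₁, h₂⟩ := ih f fun j hj => hf j (Finset.mem_insert_of_mem hj)
    rw [Finset.sup_insert, hsup]
    refine ⟨fun a ha b => ?_, AcyclicOn.sup (hJ _ hi) h₁ (hac _ hi) h₂ ?_⟩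
    · obtain ⟨x, hx, y, hy, rfl⟩ := AddSubgroup.mem_sup.1 ha
      rw [add_mul]
      exact AddSubgroup.add_mem_sup (hJ _ hi x hx b) (h₁ y hy b)
    -- By distributivity the intersection is the supremum, over the same smaller index set, of the
    -- elements `f i ⊓ f j`. These lie in `𝓕` again, so the induction hypothesis applies to this new
    -- family; hence the generalization over `f`.
    · rw [← hinf, Finset.sup_inf_distrib_left]
      exact (ih _ fun j hj => h𝓕 _ hi _ (hf j (Finset.mem_insert_of_mem hj))).2

end ChainComplex

/-! ### Acyclicity from a left unit -/

namespace CategoryTheory.ProjectiveResolution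

variable {A : Type u} [Ring A] {Z : ModuleCat.{u} A} (P : ProjectiveResolution Z)

theorem exists_d_eq_of_succ {n : ℕ} {x : P.complex.X (n + 1)} (hx : P.complex.d (n + 1) n x = 0) :
    ∃ y, P.complex.d (n + 2) (n + 1) y = x :=
  (ShortComplex.moduleCat_exact_iff _).1 (P.exact_succ n) x hx

theorem exists_d_eq_of_zero {x : P.complex.X 0} (hx : P.π.f 0 x = 0) :
    ∃ y, P.complex.d 1 0 y = x :=
  (ShortComplex.moduleCat_exact_iff _).1 (P.exact₀) x hx

/-- A right ideal generated by an idempotent which acts as zero on `Z` is acyclic on projective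
resolutions of `Z`. -/
theorem acyclicOn_of_leftUnit {J : AddSubgroup A} {e : A}
    (he : e ∈ J) (hid : ∀ a ∈ J, e * a = a) (hZ : ∀ z : Z, e • z = 0) :
    P.complex.AcyclicOn J := by
  have hid' : ∀ n, ∀ x ∈ J.smulModule (P.complex.X n), e • x = x := by
    intro n x hx
    have : J.smulModule (P.complex.X n) ≤
        (DistribSMul.toAddMonoidHom (P.complex.X n) e).eqLocus (AddMonoidHom.id _) :=
      AddSubgroup.smulModule_le fun a ha n => by
        change e • a • n = a • n
        rw [smul_smul, hid a ha]
    exact this hx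
  intro n x hx hdx
  -- The cycle bounds in the whole resolution: in degree zero because `π x = π (e • x) = e • π x =
  -- 0`. Multiplying a bounding chain by `e` moves it into `J Q` and leaves its boundary `x = e • x`
  -- unchanged.
  obtain ⟨y, rfl⟩ : ∃ y, P.complex.d (n + 1) n y = x := by
    rcases n with - | n
    · refine P.exists_d_eq_of_zero ?_
      rw [← hid' 0 x hx, map_smul]
      exact hZ _
    · exact P.exists_d_eq_of_succ (hdx n)
  exact ⟨e • y, AddSubgroup.smul_mem_smulModule he y, by rw [map_smul, hid' _ _ hx]⟩

end CategoryTheory.ProjectiveResolution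

/-! ### Reduction of modules along a split surjection onto a group algebra -/

namespace AugmentedAlgebra

open TensorProduct
open scoped ModuleCat.Algebra MonoidAlgebra

noncomputable section

variable {k : Type u} [CommRing k] {A : Type u} [Ring A] [Algebra k A] {G : Type u} [Group G]

/-- The submodule `I N` of `N`, where `I` is the kernel of `φ`. -/
def kerSMul (φ : A →ₐ[k] k[G]) (N : Type*) [AddCommGroup N] [Module A N] : Submodule A N where
  __ := (RingHom.ker φ).toAddSubgroup.smulModule N
  smul_mem' a x hx := by
    have : (RingHom.ker φ).toAddSubgroup.smulModule N ≤
        ((RingHom.ker φ).toAddSubgroup.smulModule N).comap (DistribSMul.toAddMonoidHom N a) :=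
      AddSubgroup.smulModule_le fun b hb n => by
        change a • b • n ∈ (RingHom.ker φ).toAddSubgroup.smulModule N
        rw [smul_smul]
        exact AddSubgroup.smul_mem_smulModule (J := (RingHom.ker φ).toAddSubgroup)
          ((RingHom.ker φ).mul_mem_left a hb) n
    exact this hx

section

variable (φ : A →ₐ[k] k[G]) {N N' : Type*} [AddCommGroup N] [Module A N] [AddCommGroup N']
  [Module A N']

variable {φ} in
theorem smul_mem_kerSMul {a : A} (ha : φ a = 0) (n : N) : a • n ∈ kerSMul φ N :=
  AddSubgroup.smul_mem_smulModule (J := (RingHom.ker φ).toAddSubgroup) ha n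

theorem kerSMul_le_comap (f : N →ₗ[A] N') : kerSMul φ N ≤ (kerSMul φ N').comap f :=
  fun _ hx => AddSubgroup.map_mem_smulModule f hx

end

/-- Left modules over `A` from representations of `G`, by restriction along `φ`. -/
def inflation (φ : A →ₐ[k] k[G]) : Rep.{u} k G ⥤ ModuleCat.{u} A :=
  Rep.toModuleMonoidAlgebra ⋙ ModuleCat.restrictScalars (φ : A →+* k[G])

variable (φ : A →ₐ[k] k[G]) (ψ : G →* A)

/-- The representation of `G` on `N / I N`, where `I` is the kernel of `φ`. -/
def reductionRep (N : Type u) [AddCommGroup N] [Module k N] [Module A N] [IsScalarTower k A N] :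
    Representation k G (N ⧸ kerSMul φ N) where
  toFun g := Algebra.lsmul k k (N ⧸ kerSMul φ N) (ψ g)
  map_one' := by rw [map_one, map_one]
  map_mul' g h := by rw [map_mul, map_mul]

variable {φ ψ} in
/-- The map on reductions induced by a linear map. -/
def reductionMap {N N' : Type u} [AddCommGroup N] [Module k N] [Module A N] [IsScalarTower k A N]
    [AddCommGroup N'] [Module k N'] [Module A N'] [IsScalarTower k A N'] (f : N →ₗ[A] N') :
    (reductionRep φ ψ N).IntertwiningMap (reductionRep φ ψ N') where
  toLinearMap := ((kerSMul φ N).mapQ (kerSMul φ N') f (kerSMul_le_comap φ f)).restrictScalars k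
  isIntertwining' g := LinearMap.ext fun x =>
    map_smul ((kerSMul φ N).mapQ (kerSMul φ N') f (kerSMul_le_comap φ f)) (ψ g) x

variable {φ ψ} in
theorem reductionRep_hom_ext {N : Type u} [AddCommGroup N] [Module k N] [Module A N]
    [IsScalarTower k A N] {X : Rep.{u} k G} {f g : Rep.of (reductionRep φ ψ N) ⟶ X}
    (h : ∀ x : N, f.hom (Submodule.Quotient.mk x) = g.hom (Submodule.Quotient.mk x)) : f = g :=
  Rep.hom_ext (DFunLike.ext _ _ fun x => Submodule.Quotient.induction_on _ x h)

variable {φ ψ} in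
/-- The map on the reduction of `N` induced by an additive map on `N` which is linear along `φ`. -/
def reductionDesc (h : ∀ g, φ (ψ g) = MonoidAlgebra.of k G g) {N X : Type u} [AddCommGroup N]
    [Module k N] [Module A N] [IsScalarTower k A N] [AddCommGroup X] [Module k X]
    {ρ : Representation k G X} (F : N →+ X)
    (hF : ∀ a n, F (a • n) = MonoidAlgebra.lift k (Module.End k X) G ρ (φ a) (F n)) :
    (reductionRep φ ψ N).IntertwiningMap ρ where
  toLinearMap :=
    { __ := QuotientAddGroup.lift (kerSMul φ N).toAddSubgroup F fun x hx => by
        have : (kerSMul φ N).toAddSubgroup ≤ F.ker :=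
          AddSubgroup.smulModule_le fun a ha n => by
            rw [AddMonoidHom.mem_ker, hF, show φ a = 0 from ha, map_zero, LinearMap.zero_apply]
        exact this hx
      map_smul' := fun r x => Submodule.Quotient.induction_on _ x fun x => by
        change F (r • x) = r • F x
        rw [← algebraMap_smul A r x, hF, AlgHom.commutes, AlgHom.commutes,
          Module.algebraMap_end_apply] }
  isIntertwining' g := LinearMap.ext fun x => Submodule.Quotient.induction_on _ x fun x => by
    change F (ψ g • x) = ρ g (F x)
    rw [hF, h, MonoidAlgebra.lift_of]

/-- The functor `N ↦ N / I N` from left modules over `A` to representations of `G`. -/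
def reduction : ModuleCat.{u} A ⥤ Rep.{u} k G where
  obj N := Rep.of (reductionRep φ ψ N)
  map f := Rep.ofHom (reductionMap f.hom)
  map_id _ := reductionRep_hom_ext fun _ => rfl
  map_comp _ _ := reductionRep_hom_ext fun _ => rfl

/-- The quotient map from a module to its reduction. -/
def toReduction (N : ModuleCat.{u} A) : N →ₗ[k] ((reduction φ ψ).obj N).V :=
  (kerSMul φ N).mkQ.restrictScalars k

variable {φ ψ}

theorem toReduction_surjective (N : ModuleCat.{u} A) :
    Function.Surjective (toReduction φ ψ N) := (kerSMul φ N).mkQ_surjective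

theorem reduction_hom_ext {N : ModuleCat.{u} A} {X : Rep.{u} k G} {f g : (reduction φ ψ).obj N ⟶ X}
    (h : ∀ x : N, f.hom (toReduction φ ψ N x) = g.hom (toReduction φ ψ N x)) : f = g :=
  reductionRep_hom_ext h

theorem toReduction_eq_zero {N : ModuleCat.{u} A} {x : N} :
    toReduction φ ψ N x = 0 ↔ x ∈ kerSMul φ N := Submodule.Quotient.mk_eq_zero _

instance : (reduction φ ψ).Additive where
  map_add := reduction_hom_ext fun _ => rfl

/-- The action on `N / I N` is defined through the section `ψ`, whereas linearity over `A` concerns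
all of `A`. The two are compatible because `a` differs from the image of `φ a` under the linear
extension of `ψ` by an element of `I`. -/
theorem toReduction_smul (h : ∀ g, φ (ψ g) = MonoidAlgebra.of k G g) {N : ModuleCat.{u} A} (a : A)
    (x : N) : toReduction φ ψ N (a • x) =
      MonoidAlgebra.lift k (Module.End k ((reduction φ ψ).obj N).V) G
        ((reduction φ ψ).obj N).ρ (φ a) (toReduction φ ψ N x) := by
  have key : ∀ b : k[G], φ (MonoidAlgebra.lift k A G ψ b) = b := by
    intro b
    induction b using MonoidAlgebra.induction_on with
    | of g => simpa using h g
    | add b c hb hc => rw [map_add, map_add, hb, hc]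
    | smul r b hb => rw [map_smul, map_smul, hb]
  have key₂ : ∀ b : k[G], toReduction φ ψ N (MonoidAlgebra.lift k A G ψ b • x) =
      MonoidAlgebra.lift k (Module.End k ((reduction φ ψ).obj N).V) G ((reduction φ ψ).obj N).ρ b
        (toReduction φ ψ N x) := by
    intro b
    induction b using MonoidAlgebra.induction_on with
    | of g =>
      rw [MonoidAlgebra.lift_of, MonoidAlgebra.lift_of]
      rfl
    | add b c hb hc => rw [map_add, map_add, add_smul, map_add, hb, hc, LinearMap.add_apply]
    | smul r b hb => 
      rw [map_smul (MonoidAlgebra.lift k A G ψ), smul_assoc, (toReduction φ ψ N).map_smul, hb,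
        map_smul, LinearMap.smul_apply]
  rw [← key₂, ← sub_eq_zero, ← map_sub, toReduction_eq_zero, ← sub_smul]
  exact smul_mem_kerSMul (by rw [map_sub, key, sub_self]) x

/-- A morphism from the reduction of `N` amounts to an `A`-linear map on `N`. -/
def reductionHomEquiv (h : ∀ g, φ (ψ g) = MonoidAlgebra.of k G g) (N : ModuleCat.{u} A)
    (X : Rep.{u} k G) : ((reduction φ ψ).obj N ⟶ X) ≃ (N ⟶ (inflation φ).obj X) where
  toFun f := ModuleCat.ofHom (Y := (inflation φ).obj X)
    { toFun := fun n => f.hom (toReduction φ ψ N n)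
      map_add' := fun x y => by rw [map_add]; exact map_add f.hom _ _
      map_smul' := fun a x => by
        rw [toReduction_smul h]
        exact Rep.to_Module_monoidAlgebra_map_aux _ _ _ X.ρ f.hom.toLinearMap f.hom.2 _ _ }
  invFun f := Rep.ofHom (σ := X.ρ) (reductionDesc h f.hom.toAddMonoidHom (map_smul f.hom))
  left_inv _ := reduction_hom_ext fun _ => rfl
  right_inv _ := rfl

/-- Reduction is left adjoint to inflation. -/
def reductionAdjunction (h : ∀ g, φ (ψ g) = MonoidAlgebra.of k G g) :
    reduction φ ψ ⊣ inflation φ :=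
  Adjunction.mkOfHomEquiv
    { homEquiv := reductionHomEquiv h
      homEquiv_naturality_left_symm := fun _ _ => reduction_hom_ext fun _ => rfl
      homEquiv_naturality_right := fun _ _ => rfl }

/-- The left adjoint of a functor that preserves epimorphisms preserves projective objects; this
makes the terms of the reduced resolution projective. -/
instance : (inflation φ).PreservesEpimorphisms :=
  ⟨fun f hf => (ModuleCat.epi_iff_surjective _).2 ((Rep.epi_iff_surjective f).1 hf)⟩

theorem projective_reduction (h : ∀ g, φ (ψ g) = MonoidAlgebra.of k G g) (N : ModuleCat.{u} A)
    [hN : Projective N] : Projective ((reduction φ ψ).obj N) :=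
  (reductionAdjunction h).map_projective N hN

end

end AugmentedAlgebra

namespace CategoryTheory.ProjectiveResolution

/-- A projective resolution from an augmented exact complex of projective objects. -/
noncomputable def ofExact {C : Type*} [Category* C] [Abelian C] (K : ChainComplex C ℕ)
    (hK : ∀ n, Projective (K.X n)) {Z : C} (π : K.X 0 ⟶ Z) (hπ : K.d 1 0 ≫ π = 0)
    (hex : ∀ n, (ShortComplex.mk _ _ (K.d_comp_d (n + 2) (n + 1) n)).Exact)
    (hex₀ : (ShortComplex.mk _ _ hπ).Exact) (hepi : Epi π) : ProjectiveResolution Z where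
  complex := K
  projective := hK
  π := (ChainComplex.toSingle₀Equiv _ _).symm ⟨π, hπ⟩
  quasiIso := ⟨fun n => by
    cases n
    -- In degree zero a quasi-isomorphism onto the single complex means that `π` is a cokernel of
    -- the last differential. In positive degrees the target is exact, and only exactness of `K` is
    -- left.
    · rw [ChainComplex.quasiIsoAt₀_iff, ShortComplex.quasiIso_iff_of_zeros']
      · refine (ShortComplex.exact_and_epi_g_iff_of_iso ?_).2 ⟨hex₀, hepi⟩
        exact ShortComplex.isoMk (Iso.refl _) (Iso.refl _) (Iso.refl _)
          ((Category.id_comp _).trans (Category.comp_id _).symm)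
          ((Category.id_comp _).trans
            ((ChainComplex.toSingle₀Equiv_symm_apply_f_zero π hπ).symm.trans
              (Category.comp_id _).symm))
      all_goals first | exact K.shape _ _ (by simp) | rfl
    · rename_i n
      rw [quasiIsoAt_iff_exactAt', HomologicalComplex.exactAt_iff' _ (n + 2) (n + 1) n (by simp)
        (by simp)]
      · exact hex n
      · apply ChainComplex.exactAt_succ_single_obj⟩

end CategoryTheory.ProjectiveResolution

namespace Rep

variable {k G : Type u} [CommRing k] [Group G]

theorem exact_of_exists {S : ShortComplex (Rep.{u} k G)}
    (h : ∀ x : S.X₂.V, S.g.hom x = 0 → ∃ y : S.X₁.V, S.f.hom y = x) : S.Exact := by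
  rw [← ShortComplex.exact_map_iff_of_faithful S (forget₂ (Rep.{u} k G) (ModuleCat.{u} k)),
    ShortComplex.moduleCat_exact_iff]
  exact h

end Rep

/-! ### Comparison of `Ext` with group cohomology -/

namespace AugmentedAlgebra

open TensorProduct
open scoped ModuleCat.Algebra MonoidAlgebra

noncomputable section

variable {k : Type u} [CommRing k] {A : Type u} [Ring A] [Algebra k A] {G : Type u} [Group G]
  {φ : A →ₐ[k] k[G]} {ψ : G →* A} {τ : A →ₐ[k] k}

variable (τ) in
/-- The underlying `k`-module of the trivial left module. -/
def trivialLeftEquiv : trivialLeft τ ≃ₗ[k] k where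
  toFun c := c
  invFun c := c
  map_add' _ _ := rfl
  map_smul' r c := by
    change τ (algebraMap k A r) * _ = _
    rw [AlgHom.commutes]
    rfl

variable (τ) in
/-- The underlying `k`-module of the trivial right module. -/
def trivialRightEquiv : trivialRight τ ≃ₗ[k] k where
  toFun c := c
  invFun c := c
  map_add' _ _ := rfl
  map_smul' r c := by
    change τ (algebraMap k A r) * _ = _
    rw [AlgHom.commutes]
    rfl

theorem trivialRight_op_smul (a : A) (c : trivialRight τ) : MulOpposite.op a • c = τ a • c :=
  (trivialRightEquiv τ).injective (((trivialRightEquiv τ).map_smul (τ a) c).symm ▸ rfl)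

theorem trivialLeft_smul_eq_zero {a : A} (ha : τ a = 0) (c : trivialLeft τ) : a • c = 0 := by
  refine (trivialLeftEquiv τ).injective ?_
  change τ a * trivialLeftEquiv τ c = _
  rw [ha, zero_mul, map_zero]

/-- The algebra map `MonoidAlgebra.lift k k G 1` is the augmentation of `k[G]`. In this form the
hypothesis `hτ` below says that the augmentation `τ` of `A` factors through `φ`. -/
theorem lift_trivial_apply {M : Type*} [AddCommGroup M] [Module k M] (b : k[G]) (m : M) :
    MonoidAlgebra.lift k (Module.End k M) G (Representation.trivial k G M) b m =
      MonoidAlgebra.lift k k G 1 b • m := by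
  induction b using MonoidAlgebra.induction_on with
  | of g => simp
  | add b c hb hc => rw [map_add, map_add, LinearMap.add_apply, hb, hc, add_smul]
  | smul r b hb => rw [map_smul, map_smul, LinearMap.smul_apply, hb, smul_assoc]

/-- Morphisms to the trivial module amount to morphisms from the reduction to the trivial
representation. -/
def trivialHomEquiv (h : ∀ g, φ (ψ g) = MonoidAlgebra.of k G g)
    (hτ : ∀ a, τ a = MonoidAlgebra.lift k k G 1 (φ a)) (N : ModuleCat.{u} A) :
    (N ⟶ trivialLeft τ) ≃ₗ[k] ((reduction φ ψ).obj N ⟶ Rep.trivial k G k) where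
  toFun f := Rep.ofHom (σ := Representation.trivial k G k)
    (reductionDesc (X := k) h f.hom.toAddMonoidHom fun a n => by
      rw [lift_trivial_apply, ← hτ]
      exact map_smul f.hom a n)
  invFun f := ModuleCat.ofHom (Y := trivialLeft τ)
    { toFun := fun n => f.hom (toReduction φ ψ N n)
      map_add' := fun x y => by rw [map_add]; exact map_add f.hom _ _
      map_smul' := fun a x => by
        rw [toReduction_smul h]
        refine (Rep.to_Module_monoidAlgebra_map_aux _ _ _ (Representation.trivial k G k)
          f.hom.toLinearMap f.hom.2 _ _).trans ?_
        rw [lift_trivial_apply, ← hτ]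
        rfl }
  map_add' _ _ := reduction_hom_ext fun _ => rfl
  map_smul' r f := reduction_hom_ext fun x => (trivialLeftEquiv τ).map_smul r (f.hom x)
  left_inv _ := rfl
  right_inv _ := reduction_hom_ext fun _ => rfl

/-- If the kernel of `φ` is acyclic on a projective resolution of the trivial module, then the
reduction of the resolution is a projective resolution of the trivial representation. -/
def reductionResolution (h : ∀ g, φ (ψ g) = MonoidAlgebra.of k G g)
    (hτ : ∀ a, τ a = MonoidAlgebra.lift k k G 1 (φ a)) (P : ProjectiveResolution (trivialLeft τ))
    (hac : P.complex.AcyclicOn (RingHom.ker φ).toAddSubgroup) :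
    ProjectiveResolution (Rep.trivial k G k) :=
  ProjectiveResolution.ofExact (((reduction φ ψ).mapHomologicalComplex _).obj P.complex)
    (fun n => projective_reduction h (P.complex.X n))
    (trivialHomEquiv h hτ (P.complex.X 0) (P.π.f 0))
    (reduction_hom_ext fun x =>
      congrArg (fun f : P.complex.X 1 ⟶ trivialLeft τ => f x) P.complex_d_comp_π_f_zero)
    (fun n => Rep.exact_of_exists fun x hx => by
      obtain ⟨x, rfl⟩ := toReduction_surjective (φ := φ) (ψ := ψ) _ x
      replace hx : P.complex.d (n + 1) n x ∈ kerSMul φ (P.complex.X n) :=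
        toReduction_eq_zero.1 hx
      -- A cycle of the quotient lifts to some `x` with `d x` in `I P`. This `d x` is a cycle, so
      -- acyclicity gives `y` in `I P` with `d y = d x`. The difference `x - y` is then a cycle of
      -- `P`, hence a boundary, and it represents the same class as `x` modulo `I P`.
      obtain ⟨y, hy, hdy⟩ := hac n _ hx fun m => by
        rw [← ModuleCat.comp_apply, P.complex.d_comp_d]; rfl
      obtain ⟨z, hz⟩ := P.exists_d_eq_of_succ (x := x - y) (by rw [map_sub, hdy, sub_self])
      refine ⟨toReduction φ ψ _ z, ?_⟩
      change toReduction φ ψ _ (P.complex.d (n + 2) (n + 1) z) = _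
      rw [hz, map_sub, toReduction_eq_zero.2 hy, sub_zero])
    -- At the augmentation no correction is necessary: the augmentation of the quotient complex
    -- takes the value `π x` on the class of `x`, so exactness of `P` suffices.
    (Rep.exact_of_exists fun x hx => by
      obtain ⟨x, rfl⟩ := toReduction_surjective (φ := φ) (ψ := ψ) _ x
      obtain ⟨z, hz⟩ := P.exists_d_eq_of_zero (x := x) hx
      refine ⟨toReduction φ ψ _ z, ?_⟩
      change toReduction φ ψ _ (P.complex.d 1 0 z) = _
      rw [hz])
    ((Rep.epi_iff_surjective _).2 fun c => by
      obtain ⟨x, hx⟩ := (ModuleCat.epi_iff_surjective (P.π.f 0)).1 inferInstance c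
      exact ⟨toReduction φ ψ _ x, hx⟩)

/-- The cohomology of `A` agrees with that of the group `G`. -/
theorem nonempty_cohomology_equiv (h : ∀ g, φ (ψ g) = MonoidAlgebra.of k G g)
    (hτ : ∀ a, τ a = MonoidAlgebra.lift k k G 1 (φ a)) (P : ProjectiveResolution (trivialLeft τ))
    (hac : P.complex.AcyclicOn (RingHom.ker φ).toAddSubgroup) (n : ℕ) :
    Nonempty (cohomology τ n ≃ₗ[k] groupCohomology (Rep.trivial k G k) n) := by
  let e : P.complex.linearYonedaObj k (trivialLeft τ) ≅
      (reductionResolution h hτ P hac).complex.linearYonedaObj k (Rep.trivial k G k) :=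
    HomologicalComplex.Hom.isoOfComponents
      (fun i => (trivialHomEquiv h hτ (P.complex.X i)).toModuleIso)
      (fun i j _ => ModuleCat.hom_ext <| LinearMap.ext fun f => reduction_hom_ext fun x => rfl)
  exact ⟨(P.isoExt n (trivialLeft τ) ≪≫
    (HomologicalComplex.homologyFunctor _ _ n).mapIso e ≪≫
    (groupCohomologyIso _ n (reductionResolution h hτ P hac)).symm).toLinearEquiv⟩

/-! ### Comparison of `Tor` with group homology -/

variable (τ) in
/-- The image of `c ⊗ n` in `k ⊗_A N`. -/
def trivialTensorMk (N : ModuleCat.{u} A) :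
    trivialRight τ →ₗ[k] N →ₗ[k] (tensorFunctor k (trivialRight τ)).obj N :=
  (TensorProduct.mk k (trivialRight τ) N).compr₂ (balancedRelations k (trivialRight τ) N).mkQ

theorem trivialTensorMk_smul (N : ModuleCat.{u} A) (c : trivialRight τ) (a : A) (n : N) :
    trivialTensorMk τ N c (a • n) = τ a • trivialTensorMk τ N c n := by
  rw [← LinearMap.smul_apply, ← map_smul, ← trivialRight_op_smul]
  exact ((Submodule.Quotient.eq (balancedRelations k (trivialRight τ) N)).2
    (Submodule.subset_span ⟨a, c, n, rfl⟩)).symm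

theorem coinvariantsTensorMk_ρ (M : Rep.{u} k G) (c : k) (g : G) (m : M.V) :
    Rep.coinvariantsTensorMk (Rep.trivial k G k) M c (M.ρ g m) =
      Rep.coinvariantsTensorMk (Rep.trivial k G k) M c m :=
  Representation.Coinvariants.mk_self_apply ((Rep.trivial k G k).ρ.tprod M.ρ) g (c ⊗ₜ[k] m)

/-- For fixed `c`, the class of `c ⊗ m` in the coinvariants is unchanged when `G` acts on `m` alone,
since `G` fixes `c`. So `m ↦ [c ⊗ m]` intertwines with a trivial representation, and the group
algebra acts on the target through its augmentation. -/
theorem coinvariantsTensorMk_lift (M : Rep.{u} k G) (c : k) (b : k[G]) (m : M.V) :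
    Rep.coinvariantsTensorMk (Rep.trivial k G k) M c
        (MonoidAlgebra.lift k (Module.End k M.V) G M.ρ b m) =
      MonoidAlgebra.lift k k G 1 b • Rep.coinvariantsTensorMk (Rep.trivial k G k) M c m := by
  rw [← lift_trivial_apply]
  exact Rep.to_Module_monoidAlgebra_map_aux _ _ _ (Representation.trivial k G _)
    (Rep.coinvariantsTensorMk (Rep.trivial k G k) M c)
    (fun g => LinearMap.ext fun m => coinvariantsTensorMk_ρ M c g m) b m

/-- The map from the tensor product of the trivial module with `N` to the coinvariants of the
reduction of `N`. -/
def trivialTensorHom (h : ∀ g, φ (ψ g) = MonoidAlgebra.of k G g)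
    (hτ : ∀ a, τ a = MonoidAlgebra.lift k k G 1 (φ a)) (N : ModuleCat.{u} A) :
    (tensorFunctor k (trivialRight τ)).obj N →ₗ[k]
      ((Rep.coinvariantsTensor k G).obj (Rep.trivial k G k)).obj ((reduction φ ψ).obj N) :=
  (balancedRelations k (trivialRight τ) N).liftQ
    (TensorProduct.lift ((Rep.coinvariantsTensorMk (Rep.trivial k G k)
      ((reduction φ ψ).obj N)).compl₁₂ (trivialRightEquiv τ).toLinearMap (toReduction φ ψ N)))
    (Submodule.span_le.2 <| by
      rintro _ ⟨a, c, n, rfl⟩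
      rw [SetLike.mem_coe, LinearMap.mem_ker, map_sub, TensorProduct.lift.tmul,
        TensorProduct.lift.tmul, LinearMap.compl₁₂_apply, LinearMap.compl₁₂_apply,
        toReduction_smul h, coinvariantsTensorMk_lift, ← hτ, trivialRight_op_smul, map_smul,
        map_smul, LinearMap.smul_apply, sub_self])

/-- The inverse of `trivialTensorHom`. -/
def trivialTensorInv (h : ∀ g, φ (ψ g) = MonoidAlgebra.of k G g)
    (hτ : ∀ a, τ a = MonoidAlgebra.lift k k G 1 (φ a)) (N : ModuleCat.{u} A) :
    ((Rep.coinvariantsTensor k G).obj (Rep.trivial k G k)).obj ((reduction φ ψ).obj N) →ₗ[k]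
      (tensorFunctor k (trivialRight τ)).obj N :=
  -- The map `n ↦ (c ↦ c ⊗ n)` turns the action of `a` into the scalar `τ a`, so it kills `I N` and
  -- descends to the reduction, with the trivial action of `G` on the target.
  let D := reductionDesc (ρ := Representation.trivial k G _) h
    (trivialTensorMk τ N).flip.toAddMonoidHom fun a n => by
      rw [lift_trivial_apply, ← hτ]
      exact LinearMap.ext fun c => trivialTensorMk_smul N c a n
  Representation.Coinvariants.lift _ (TensorProduct.lift
    (D.toLinearMap.flip ∘ₗ (trivialRightEquiv τ).symm.toLinearMap)) fun g =>
      TensorProduct.ext' fun c m => LinearMap.congr_fun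
        (LinearMap.congr_fun (D.isIntertwining' g) m) _

/-- The tensor product of the trivial module with `N` as coinvariants of the reduction of `N`. -/
def trivialTensorEquiv (h : ∀ g, φ (ψ g) = MonoidAlgebra.of k G g)
    (hτ : ∀ a, τ a = MonoidAlgebra.lift k k G 1 (φ a)) (N : ModuleCat.{u} A) :
    (tensorFunctor k (trivialRight τ)).obj N ≃ₗ[k]
      ((Rep.coinvariantsTensor k G).obj (Rep.trivial k G k)).obj ((reduction φ ψ).obj N) :=
  LinearEquiv.ofLinearMap (trivialTensorHom h hτ N) (trivialTensorInv h hτ N)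
    (Representation.Coinvariants.hom_ext <| TensorProduct.ext' fun c m => by
      obtain ⟨x, rfl⟩ := toReduction_surjective (φ := φ) (ψ := ψ) _ m
      rfl)
    (Submodule.linearMap_qext _ <| TensorProduct.ext' fun c m => rfl)

/-- The homology of `A` agrees with that of the group `G`. -/
theorem nonempty_homology_equiv (h : ∀ g, φ (ψ g) = MonoidAlgebra.of k G g)
    (hτ : ∀ a, τ a = MonoidAlgebra.lift k k G 1 (φ a)) (P : ProjectiveResolution (trivialLeft τ))
    (hac : P.complex.AcyclicOn (RingHom.ker φ).toAddSubgroup) (n : ℕ) :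
    Nonempty (homology τ n ≃ₗ[k] groupHomology (Rep.trivial k G k) n) := by
  classical
  let e : ((tensorFunctor k (trivialRight τ)).mapHomologicalComplex _).obj P.complex ≅
      (reductionResolution h hτ P hac).complex.coinvariantsTensorObj (Rep.trivial k G k) :=
    HomologicalComplex.Hom.isoOfComponents
      (fun i => (trivialTensorEquiv h hτ (P.complex.X i)).toModuleIso)
      (fun i j _ => ModuleCat.hom_ext <| Submodule.linearMap_qext _ <|
        TensorProduct.ext' fun c m => rfl)
  exact ⟨(P.isoLeftDerivedObj (tensorFunctor k (trivialRight τ)) n ≪≫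
    (HomologicalComplex.homologyFunctor _ _ n).mapIso e ≪≫
    (groupHomologyIso _ n (reductionResolution h hτ P hac)).symm).toLinearEquiv⟩

end

end AugmentedAlgebra

/-! ### Arc diagrams and permutation diagrams -/

namespace BrauerDiagram

open SimpleGraph

section

variable {V : Type}

/-- The diagram given by a fixed point free involution. -/
def ofInvolutive (f : V ⊕ V → V ⊕ V) (hf : Function.Involutive f) (hne : ∀ x, f x ≠ x) :
    BrauerDiagram V where
  graph :=
    { Adj := fun x y => f x = y
      symm := ⟨fun x y h => by rw [← h, hf x]⟩
      loopless := ⟨fun x h => hne x h⟩ }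
  existsUnique_adj x := ⟨f x, rfl, fun _ h => Eq.symm h⟩

/-- One inclusion of edge sets is enough, because each vertex lies on exactly one edge in either
diagram. -/
theorem eq_of_adj {d d' : BrauerDiagram V} (h : ∀ x y, d.graph.Adj x y → d'.graph.Adj x y) :
    d = d' := by
  refine BrauerDiagram.ext (SimpleGraph.ext ?_)
  ext x y
  refine ⟨h x y, fun hxy => ?_⟩
  obtain ⟨z, hz, -⟩ := d.existsUnique_adj x
  rwa [(d'.existsUnique_adj x).unique hxy (h x z hz)]

/-- Arcs of the left-hand column survive multiplication on the right. This is why prescribing such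
arcs cuts out right ideals. -/
theorem mul_adj_inl [Finite V] {d : BrauerDiagram V} {i j : V}
    (h : d.graph.Adj (Sum.inl i) (Sum.inl j)) (d' : BrauerDiagram V) :
    (d * d').graph.Adj (Sum.inl i) (Sum.inl j) :=
  ⟨h.ne, (stack_adj_left h).reachable⟩

section arcs

variable [DecidableEq V]

/-- The partner map of the diagram with an arc between `a` and `b` in either column, in which all
other edges are horizontal. -/
def arcsPartner (a b : V) : V ⊕ V → V ⊕ V
  | Sum.inl i => if i = a ∨ i = b then Sum.inl (Equiv.swap a b i) else Sum.inr i
  | Sum.inr i => if i = a ∨ i = b then Sum.inr (Equiv.swap a b i) else Sum.inl i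

/-- The diagram with an arc between `a` and `b` in either column, in which all other edges are
horizontal. -/
def arcs {a b : V} (hab : a ≠ b) : BrauerDiagram V :=
  ofInvolutive (arcsPartner a b)
    (by
      have key : ∀ i, i = a ∨ i = b → Equiv.swap a b i = a ∨ Equiv.swap a b i = b := by
        rintro i (rfl | rfl) <;> simp
      rintro (i | i) <;> by_cases h : i = a ∨ i = b <;> simp [arcsPartner, h, key])
    (by
      have key : ∀ i, i = a ∨ i = b → Equiv.swap a b i ≠ i := by
        rintro i (rfl | rfl)
        · simpa using hab.symm
        · simpa using hab
      rintro (i | i) <;> by_cases h : i = a ∨ i = b <;> simp [arcsPartner, h, key])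

variable {a b : V} (hab : a ≠ b)

theorem arcs_adj (x y : V ⊕ V) : (arcs hab).graph.Adj x y ↔ arcsPartner a b x = y := Iff.rfl

theorem arcs_adj_inl : (arcs hab).graph.Adj (Sum.inl a) (Sum.inl b) := by
  simp [arcs_adj, arcsPartner]

theorem arcs_adj_inl_inr {i : V} (ha : i ≠ a) (hb : i ≠ b) :
    (arcs hab).graph.Adj (Sum.inl i) (Sum.inr i) := by
  simp [arcs_adj, arcsPartner, ha, hb]

variable [Finite V]

/-- Multiplication with an arc diagram preserves edges which are disjoint from the arc. -/
theorem arcs_mul_adj {d : BrauerDiagram V} {x y : V ⊕ V} (h : d.graph.Adj x y)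
    (hx : ∀ i, x = Sum.inl i → i ≠ a ∧ i ≠ b) (hy : ∀ i, y = Sum.inl i → i ≠ a ∧ i ≠ b) :
    (arcs hab * d).graph.Adj x y := by
  have key : ∀ x : V ⊕ V, (∀ i, x = Sum.inl i → i ≠ a ∧ i ≠ b) →
      (stack (arcs hab) d).Reachable (outer x) (middleRight x) := by
    rintro (i | i) hi
    · exact (stack_adj_left (arcs_adj_inl_inr hab (hi i rfl).1 (hi i rfl).2)).reachable
    · exact .rfl
  exact ⟨h.ne, ((key x hx).trans (stack_adj_right h).reachable).trans (key y hy).symm⟩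

/-- The arc of `d` closes up with the right-hand arc of `arcs hab` to a loop and is replaced by the
left-hand arc between the same vertices. All other edges of `d` are merely prolonged by horizontal
ones. -/
theorem arcs_mul {d : BrauerDiagram V} (h : d.graph.Adj (Sum.inl a) (Sum.inl b)) :
    arcs hab * d = d := by
  symm
  refine eq_of_adj fun x y hxy => ?_
  by_cases hxa : x = Sum.inl a
  · subst hxa
    rw [(d.existsUnique_adj _).unique hxy h]
    exact mul_adj_inl (arcs_adj_inl hab) d
  by_cases hxb : x = Sum.inl b
  · subst hxb
    rw [(d.existsUnique_adj _).unique hxy h.symm]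
    exact (mul_adj_inl (arcs_adj_inl hab) d).symm
  -- What remains are edges away from the arc: if `y` were one of its ends, uniqueness of edges
  -- would make `x` the other end.
  refine arcs_mul_adj hab hxy (fun i hi => ⟨?_, ?_⟩) (fun i hi => ⟨?_, ?_⟩)
  · rintro rfl; exact hxa hi
  · rintro rfl; exact hxb hi
  · rintro rfl
    exact hxb ((d.existsUnique_adj _).unique (hi ▸ hxy.symm) h)
  · rintro rfl
    exact hxa ((d.existsUnique_adj _).unique (hi ▸ hxy.symm) h.symm)

/-- The number of loops in a product with an arc diagram does not depend on the second factor, as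
long as the latter contains the arc. -/
theorem loops_arcs {d : BrauerDiagram V} (h : d.graph.Adj (Sum.inl a) (Sum.inl b)) :
    loops (arcs hab) d = loops (arcs hab) (arcs hab) := by
  -- Both `arcs hab * arcs hab` and `arcs hab * d` are absorbed, so the cocycle identity for loop
  -- numbers becomes an identity with one term to cancel. The actual number of loops never has to be
  -- computed.
  have := loops_assoc (arcs hab) (arcs hab) d
  rw [arcs_mul hab (arcs_adj_inl hab), arcs_mul hab h] at this
  lia

end arcs

/-- The diagram of a permutation. -/
def ofPerm (σ : Equiv.Perm V) : BrauerDiagram V :=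
  -- The edges run from `σ i` on the left to `i` on the right; with this orientation stacking
  -- corresponds to composition in its usual order.
  ofInvolutive (Sum.elim (fun i => Sum.inr (σ⁻¹ i)) (fun i => Sum.inl (σ i)))
    (by rintro (i | i) <;> simp) (by rintro (i | i) <;> simp)

theorem ofPerm_adj (σ : Equiv.Perm V) (i : V) :
    (ofPerm σ).graph.Adj (Sum.inl (σ i)) (Sum.inr i) := by
  change Sum.inr (σ⁻¹ (σ i)) = Sum.inr i
  simp

theorem ofPerm_adj_iff (σ : Equiv.Perm V) (i j : V) :
    (ofPerm σ).graph.Adj (Sum.inl i) (Sum.inr j) ↔ i = σ j := by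
  refine ⟨fun h => ?_, fun h => h ▸ ofPerm_adj σ j⟩
  exact Sum.inl_injective (((ofPerm σ).existsUnique_adj _).unique h.symm (ofPerm_adj σ j).symm)

theorem isPermutation_ofPerm (σ : Equiv.Perm V) : (ofPerm σ).IsPermutation := fun i =>
  ⟨σ⁻¹ i, (ofPerm_adj_iff σ i _).2 (by simp)⟩

theorem ofPerm_injective : Function.Injective (ofPerm (V := V)) := by
  intro σ τ h
  ext i
  rw [← ofPerm_adj_iff, ← h]
  exact ofPerm_adj σ i

theorem eq_ofPerm {d : BrauerDiagram V} {σ : Equiv.Perm V}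
    (h : ∀ i, d.graph.Adj (Sum.inl (σ i)) (Sum.inr i)) : ofPerm σ = d := by
  refine eq_of_adj fun x y hxy => ?_
  rcases x with i | i <;> obtain rfl := hxy
  · simpa using h (σ⁻¹ i)
  · exact (h i).symm

theorem ofPerm_one : ofPerm (1 : Equiv.Perm V) = 1 := eq_ofPerm fun _ => rfl

theorem ofPerm_mul [Finite V] (σ τ : Equiv.Perm V) : ofPerm (σ * τ) = ofPerm σ * ofPerm τ :=
  eq_ofPerm fun i => ⟨Sum.inl_ne_inr, (stack_adj_left (ofPerm_adj σ (τ i))).reachable.trans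
    (stack_adj_right (ofPerm_adj τ i)).reachable⟩

theorem IsPermutation.exists_ofPerm [Finite V] {d : BrauerDiagram V} (h : d.IsPermutation) :
    ∃ σ, ofPerm σ = d := by
  rw [isPermutation_iff_exists_right] at h
  choose f hf using h
  have hinj : Function.Injective f := by
    intro i j hij
    have := hf i
    rw [hij] at this
    exact Sum.inr_injective ((d.existsUnique_adj _).unique this (hf j))
  exact ⟨Equiv.ofBijective f (Finite.injective_iff_bijective.1 hinj), eq_ofPerm hf⟩

end

/-! ### Walled diagrams with prescribed arcs -/

section walled

variable {r s : ℕ}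

/-- The group `Σ_r × Σ_s`, lifted to an arbitrary universe. -/
abbrev PermPair (r s : ℕ) : Type u := ULift.{u} (Equiv.Perm (Fin r) × Equiv.Perm (Fin s))

/-- The walled diagram of a pair of permutations. -/
def ofPermPair (g : PermPair.{u} r s) : BrauerDiagram (Fin r ⊕ Fin s) :=
  ofPerm (Equiv.Perm.sumCongrHom _ _ g.down)

theorem ofPermPair_one : ofPermPair (1 : PermPair.{u} r s) = 1 := by
  rw [← ofPerm_one, ← map_one (Equiv.Perm.sumCongrHom (Fin r) (Fin s))]
  rfl

theorem ofPermPair_mul (g h : PermPair.{u} r s) :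
    ofPermPair (g * h) = ofPermPair g * ofPermPair h := by
  rw [ofPermPair, ofPermPair, ofPermPair, ← ofPerm_mul, ← map_mul]
  rfl

theorem ofPermPair_injective : Function.Injective (ofPermPair.{u} (r := r) (s := s)) :=
  ofPerm_injective.comp (Equiv.Perm.sumCongrHom_injective.comp ULift.down_injective)

theorem isPermutation_ofPermPair (g : PermPair.{u} r s) : (ofPermPair g).IsPermutation :=
  isPermutation_ofPerm _

theorem isWalled_ofPermPair (g : PermPair.{u} r s) : (ofPermPair g).IsWalled := by
  rw [isWalled_iff]
  rintro ((i | i) | (i | i)) _ rfl <;> simp [side₂, side]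

theorem IsWalled.exists_ofPermPair {d : BrauerDiagram (Fin r ⊕ Fin s)} (hd : d.IsWalled)
    (h : d.IsPermutation) : ∃ g : PermPair.{u} r s, ofPermPair g = d := by
  obtain ⟨σ, rfl⟩ := h.exists_ofPerm
  obtain ⟨g, hg⟩ := Equiv.Perm.mem_sumCongrHom_range_of_perm_mapsTo_inl (σ := σ) (by
    rintro _ ⟨i, rfl⟩
    have := (hd.propagating _ _ (ofPerm_adj σ (Sum.inl i))).2 rfl
    obtain ⟨j, hj⟩ := Sum.isLeft_iff.1 this
    exact ⟨j, hj.symm⟩)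
  exact ⟨⟨g⟩, by rw [ofPermPair, hg]⟩

/-- The diagrams whose left-hand column contains all the given edges, each of which joins one of
the first `r` vertices to one of the last `s` vertices. -/
def withEdges (S : Set (Fin r × Fin s)) : Set (BrauerDiagram (Fin r ⊕ Fin s)) :=
  {d | ∀ e ∈ S, d.graph.Adj (Sum.inl (Sum.inl e.1)) (Sum.inl (Sum.inr e.2))}

/-- Hence the family of sets `withEdges S` is closed under intersections, as the Mayer–Vietoris
induction requires. -/
theorem withEdges_union (S T : Set (Fin r × Fin s)) :
    withEdges (S ∪ T) = withEdges S ∩ withEdges T := by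
  ext d
  simp only [withEdges, Set.mem_ofPred_eq, Set.mem_inter_iff, Set.mem_union, or_imp, forall_and]

theorem mul_mem_withEdges {S : Set (Fin r × Fin s)} {d : BrauerDiagram (Fin r ⊕ Fin s)}
    (h : d ∈ withEdges S) (d' : BrauerDiagram (Fin r ⊕ Fin s)) : d * d' ∈ withEdges S :=
  fun e he => mul_adj_inl (h e he) d'

theorem withEdges_not_isPermutation {S : Set (Fin r × Fin s)} (hS : S.Nonempty)
    {d : BrauerDiagram (Fin r ⊕ Fin s)} (h : d ∈ withEdges S) : ¬ d.IsPermutation := by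
  obtain ⟨e, he⟩ := hS
  rw [isPermutation_iff_left]
  exact fun hd => hd _ _ (h e he)

/-- This lets the right ideals of single arcs cover the ideal of diagrams that are not permutations.
An arc within the left-hand column crosses the wall, so it is given by a pair in `Fin r × Fin s`. -/
theorem IsWalled.exists_mem_withEdges {d : BrauerDiagram (Fin r ⊕ Fin s)} (hd : d.IsWalled)
    (h : ¬ d.IsPermutation) : ∃ e, d ∈ withEdges {e} := by
  rw [isPermutation_iff_left] at h
  push Not at h
  obtain ⟨i, j, hij⟩ := h
  have := hd.left i j hij
  rcases i with i | i <;> rcases j with j | j <;> simp at this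
  · exact ⟨(i, j), by rintro _ rfl; exact hij⟩
  · exact ⟨(j, i), by rintro _ rfl; exact hij.symm⟩

/-- The diagram with the edge `e` in either column, in which all other edges are horizontal. -/
def edgeDiagram (e : Fin r × Fin s) : BrauerDiagram (Fin r ⊕ Fin s) :=
  arcs (a := Sum.inl e.1) (b := Sum.inr e.2) Sum.inl_ne_inr

theorem edgeDiagram_mem (e : Fin r × Fin s) : edgeDiagram e ∈ withEdges {e} := by
  rintro _ rfl
  exact arcs_adj_inl _

theorem isWalled_edgeDiagram (e : Fin r × Fin s) : (edgeDiagram e).IsWalled := by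
  rw [isWalled_iff]
  rintro (i | i) _ rfl
  all_goals
    rw [arcsPartner]
    split_ifs with h
    · rcases h with rfl | rfl <;> simp [side₂, side]
    · simp [side₂]

theorem edgeDiagram_mul {e : Fin r × Fin s} {d : BrauerDiagram (Fin r ⊕ Fin s)}
    (h : d ∈ withEdges {e}) : edgeDiagram e * d = d :=
  arcs_mul _ (h e rfl)

theorem loops_edgeDiagram {e : Fin r × Fin s} {d : BrauerDiagram (Fin r ⊕ Fin s)}
    (h : d ∈ withEdges {e}) : loops (edgeDiagram e) d = loops (edgeDiagram e) (edgeDiagram e) :=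
  loops_arcs _ (h e rfl)

/-- Arcs that avoid both ends of `e` only meet horizontal edges of `edgeDiagram e`. This keeps a
product of left units inside the ideal of the later factor. -/
theorem edgeDiagram_mul_mem {e : Fin r × Fin s} {S : Set (Fin r × Fin s)}
    (he : ∀ f ∈ S, f.1 ≠ e.1 ∧ f.2 ≠ e.2) {d : BrauerDiagram (Fin r ⊕ Fin s)}
    (h : d ∈ withEdges S) : edgeDiagram e * d ∈ withEdges S := by
  refine fun f hf => arcs_mul_adj _ (h f hf) ?_ ?_
  · rintro _ ⟨⟩
    simpa using (he f hf).1
  · rintro _ ⟨⟩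
    simpa using (he f hf).2

/-- Two distinct edges of a diagram are disjoint. -/
theorem eq_of_mem_withEdges {e f : Fin r × Fin s} {d : BrauerDiagram (Fin r ⊕ Fin s)}
    (he : d ∈ withEdges {e}) (hf : d ∈ withEdges {f}) (h : f.1 = e.1 ∨ f.2 = e.2) : f = e := by
  replace he := he e rfl
  replace hf := hf f rfl
  rcases h with h | h
  · rw [h] at hf
    have := (d.existsUnique_adj _).unique hf he
    exact Prod.ext h (by simpa using this)
  · rw [h] at hf
    have := (d.existsUnique_adj _).unique hf.symm he.symm
    exact Prod.ext (by simpa using this) h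

end walled

end BrauerDiagram

/-! ### Ideals of the walled Brauer algebra -/

namespace BrauerAlgebra

open BrauerDiagram

noncomputable section

variable {k : Type u} [CommRing k] {V : Type} {δ : k}

variable (k δ) in
/-- The span of a set of diagrams. -/
def spanOf (D : Set (BrauerDiagram V)) : Submodule k (BrauerAlgebra k V δ) :=
  Submodule.span k (basis k V δ '' D)

theorem mem_spanOf {D : Set (BrauerDiagram V)} {a : BrauerAlgebra k V δ} :
    a ∈ spanOf k δ D ↔ ∀ d, (basis k V δ).repr a d ≠ 0 → d ∈ D := by
  rw [spanOf, Module.Basis.mem_span_image]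
  simp [Set.subset_def]

theorem of_mem_spanOf {D : Set (BrauerDiagram V)} {d : BrauerDiagram V} (h : d ∈ D) :
    of δ d ∈ spanOf k δ D :=
  Submodule.subset_span ⟨d, h, rfl⟩

theorem spanOf_mono {D E : Set (BrauerDiagram V)} (h : D ⊆ E) : spanOf k δ D ≤ spanOf k δ E :=
  Submodule.span_mono (Set.image_mono h)

/-- Valid since the diagrams are a basis: membership is a condition on the support. Together with
`spanOf_sup` it transfers distributivity from sets of diagrams to their spans. -/
theorem spanOf_inf (D E : Set (BrauerDiagram V)) :
    spanOf k δ (D ∩ E) = spanOf k δ D ⊓ spanOf k δ E := by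
  ext a
  simp only [Submodule.mem_inf, mem_spanOf, Set.mem_inter_iff]
  grind

theorem spanOf_sup (D E : Set (BrauerDiagram V)) :
    spanOf k δ (D ∪ E) = spanOf k δ D ⊔ spanOf k δ E := by
  rw [spanOf, Set.image_union, Submodule.span_union]
  rfl

theorem spanOf_empty : spanOf k δ (∅ : Set (BrauerDiagram V)) = ⊥ := by
  rw [spanOf, Set.image_empty, Submodule.span_empty]

/-- Two linear maps agree on a span of diagrams if they agree on the diagrams. -/
theorem eqOn_spanOf {M : Type*} [AddCommMonoid M] [Module k M] {D : Set (BrauerDiagram V)}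
    {f g : BrauerAlgebra k V δ →ₗ[k] M} (h : ∀ d ∈ D, f (of δ d) = g (of δ d))
    {a : BrauerAlgebra k V δ} (ha : a ∈ spanOf k δ D) : f a = g a := by
  refine LinearMap.eqOn_span ?_ ha
  rintro _ ⟨d, hd, rfl⟩
  exact h d hd

theorem map_mem_of_mem_spanOf {M : Type*} [AddCommMonoid M] [Module k M]
    {D : Set (BrauerDiagram V)} {f : BrauerAlgebra k V δ →ₗ[k] M} {S : Submodule k M}
    (h : ∀ d ∈ D, f (of δ d) ∈ S) {a : BrauerAlgebra k V δ} (ha : a ∈ spanOf k δ D) : f a ∈ S := by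
  have : spanOf k δ D ≤ S.comap f := by
    refine Submodule.span_le.2 ?_
    rintro _ ⟨d, hd, rfl⟩
    exact h d hd
  exact this ha

variable [Finite V]

theorem mul_mem_spanOf {D E F : Set (BrauerDiagram V)} (h : ∀ d ∈ D, ∀ e ∈ E, d * e ∈ F)
    {a b : BrauerAlgebra k V δ} (ha : a ∈ spanOf k δ D) (hb : b ∈ spanOf k δ E) :
    a * b ∈ spanOf k δ F := by
  refine map_mem_of_mem_spanOf (f := LinearMap.mulLeft k a) (fun e he => ?_) hb
  refine map_mem_of_mem_spanOf (f := LinearMap.mulRight k (of δ e)) (fun d hd => ?_) ha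
  rw [LinearMap.mulRight_apply, of_mul_of]
  exact Submodule.smul_mem _ _ (of_mem_spanOf (h d hd e he))

end

end BrauerAlgebra

/-! ### Right ideals of prescribed arcs and their left units -/

namespace walledBrauerAlgebra

open BrauerDiagram BrauerAlgebra
open scoped MonoidAlgebra

noncomputable section

variable {k : Type u} [CommRing k] {r s : ℕ} {δ : k}

theorem mem_iff {a : BrauerAlgebra k (Fin r ⊕ Fin s) δ} :
    a ∈ walledBrauerAlgebra k r s δ ↔
      a ∈ spanOf k δ {d : BrauerDiagram (Fin r ⊕ Fin s) | d.IsWalled} := by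
  change a ∈ Submodule.span k _ ↔ _
  rw [spanOf]
  congr! 2
  ext b
  exact ⟨fun ⟨d, hd, h⟩ => ⟨d, hd, h.symm⟩, fun ⟨d, hd, h⟩ => ⟨d, hd, h.symm⟩⟩

theorem of_mem {d : BrauerDiagram (Fin r ⊕ Fin s)} (hd : d.IsWalled) :
    of δ d ∈ walledBrauerAlgebra k r s δ := mem_iff.2 (of_mem_spanOf hd)

variable (k δ) in
/-- The elements of the walled Brauer algebra which are supported on a set of diagrams. -/
def supported (D : Set (BrauerDiagram (Fin r ⊕ Fin s))) :
    AddSubgroup (walledBrauerAlgebra k r s δ) :=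
  (spanOf k δ D).toAddSubgroup.comap (walledBrauerAlgebra k r s δ).val.toLinearMap.toAddMonoidHom

theorem mem_supported {D : Set (BrauerDiagram (Fin r ⊕ Fin s))} {a : walledBrauerAlgebra k r s δ} :
    a ∈ supported k δ D ↔ (a : BrauerAlgebra k (Fin r ⊕ Fin s) δ) ∈ spanOf k δ D := Iff.rfl

theorem supported_empty : supported k δ (∅ : Set (BrauerDiagram (Fin r ⊕ Fin s))) = ⊥ := by
  ext a
  rw [mem_supported, spanOf_empty, Submodule.mem_bot, AddSubgroup.mem_bot, ZeroMemClass.coe_eq_zero]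

theorem supported_inf (D E : Set (BrauerDiagram (Fin r ⊕ Fin s))) :
    supported k δ (D ∩ E) = supported k δ D ⊓ supported k δ E := by
  ext a
  rw [AddSubgroup.mem_inf, mem_supported, mem_supported, mem_supported, spanOf_inf,
    Submodule.mem_inf]

theorem supported_sup (D E : Set (BrauerDiagram (Fin r ⊕ Fin s))) :
    supported k δ (D ∪ E) = supported k δ D ⊔ supported k δ E := by
  refine le_antisymm (fun a ha => ?_) (sup_le ?_ ?_)
  -- Discarding the diagrams that are not walled before splitting ensures that both summands stay in
  -- the subalgebra.
  · have h : (a : BrauerAlgebra k (Fin r ⊕ Fin s) δ) ∈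
        spanOf k δ ((D ∪ E) ∩ {d | d.IsWalled}) := by
      rw [spanOf_inf]
      exact ⟨ha, mem_iff.1 a.2⟩
    rw [Set.union_inter_distrib_right, spanOf_sup] at h
    obtain ⟨x, hx, y, hy, hxy⟩ := Submodule.mem_sup.1 h
    refine AddSubgroup.mem_sup.2
      ⟨⟨x, mem_iff.2 (spanOf_mono Set.inter_subset_right hx)⟩,
        spanOf_mono Set.inter_subset_left hx,
        ⟨y, mem_iff.2 (spanOf_mono Set.inter_subset_right hy)⟩,
        spanOf_mono Set.inter_subset_left hy, Subtype.ext hxy⟩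
  · exact fun a ha => spanOf_mono Set.subset_union_left ha
  · exact fun a ha => spanOf_mono Set.subset_union_right ha

theorem mul_mem_supported (S : Set (Fin r × Fin s)) {a : walledBrauerAlgebra k r s δ}
    (ha : a ∈ supported k δ (withEdges S)) (b : walledBrauerAlgebra k r s δ) :
    a * b ∈ supported k δ (withEdges S) :=
  mul_mem_spanOf (fun _ hd e _ => mul_mem_withEdges hd e) ha (mem_iff.1 b.2)

/-- For an invertible parameter, the right ideal spanned by the diagrams with given edges has a
left unit. -/
theorem exists_leftUnit (hδ : IsUnit δ) {S : Finset (Fin r × Fin s)} (hS : S.Nonempty) :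
    ∃ e ∈ supported k δ (withEdges (S : Set (Fin r × Fin s))),
      ∀ a ∈ supported k δ (withEdges (S : Set (Fin r × Fin s))), e * a = a := by
  have single : ∀ e : Fin r × Fin s, ∃ ε ∈ supported k δ (withEdges {e}),
      (∀ a ∈ supported k δ (withEdges {e}), ε * a = a) ∧
      ∀ S : Set (Fin r × Fin s), (∀ f ∈ S, f.1 ≠ e.1 ∧ f.2 ≠ e.2) →
        ∀ a ∈ supported k δ (withEdges S), ε * a ∈ supported k δ (withEdges S) := by
    intro e
    -- The left unit for one arc is the arc diagram divided by the power of `δ` that it produces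
    -- against any diagram containing the arc.
    obtain ⟨c, hc⟩ := (hδ.pow (loops (edgeDiagram e) (edgeDiagram e))).exists_left_inv
    refine ⟨⟨c • of δ (edgeDiagram e), Subalgebra.smul_mem _ (of_mem (isWalled_edgeDiagram e)) c⟩,
      Submodule.smul_mem _ c (of_mem_spanOf (edgeDiagram_mem e)), fun a ha => Subtype.ext ?_,
      fun S hS a ha => ?_⟩
    · refine eqOn_spanOf (f := LinearMap.mulLeft k (c • of δ (edgeDiagram e)))
        (g := LinearMap.id) (fun d hd => ?_) ha
      rw [LinearMap.mulLeft_apply, smul_mul_assoc, of_mul_of, loops_edgeDiagram hd,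
        edgeDiagram_mul hd, smul_smul, hc, one_smul, LinearMap.id_apply]
    · exact mul_mem_spanOf (D := {edgeDiagram e})
        (by rintro _ rfl d hd; exact edgeDiagram_mul_mem hS hd)
        (Submodule.smul_mem _ c (of_mem_spanOf rfl)) ha
  induction hS using Finset.Nonempty.cons_induction with
  | singleton e =>
    obtain ⟨ε, h₁, h₂, -⟩ := single e
    rw [Finset.coe_singleton]
    exact ⟨ε, h₁, h₂⟩
  | cons e S heS _ ih =>
    obtain ⟨η, hη, hη'⟩ := ih
    obtain ⟨ε, hε, hε', hεS⟩ := single e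
    have hcons : withEdges ((Finset.cons e S heS : Finset _) : Set (Fin r × Fin s)) =
        withEdges {e} ∩ withEdges (S : Set (Fin r × Fin s)) := by
      rw [Finset.coe_cons, Set.insert_eq, withEdges_union]
    rw [hcons]
    -- If `e` is disjoint from the arcs in `S`, then `ε * η` lies in both ideals, and it fixes the
    -- intersection because `η` and then `ε` do. Otherwise `e` shares a vertex with another arc, no
    -- diagram contains both, and zero is a left unit of the zero ideal.
    by_cases h : ∀ f ∈ S, f.1 ≠ e.1 ∧ f.2 ≠ e.2
    · rw [supported_inf]
      refine ⟨ε * η, ⟨mul_mem_supported _ hε η, hεS _ h η hη⟩, fun a ha => ?_⟩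
      rw [mul_assoc, hη' a ha.2, hε' a ha.1]
    · have hempty : withEdges {e} ∩ withEdges (S : Set (Fin r × Fin s)) = ∅ := by
        push Not at h
        obtain ⟨f, hf, hfe⟩ := h
        refine Set.eq_empty_of_forall_notMem fun d hd => heS ?_
        rwa [← eq_of_mem_withEdges (f := f) hd.1 (by rintro _ rfl; exact hd.2 _ hf)
          (or_iff_not_imp_left.2 hfe)]
      rw [hempty, supported_empty]
      exact ⟨0, zero_mem _, fun a ha => by rw [AddSubgroup.mem_bot.1 ha, mul_zero]⟩

/-! ### The quotient group algebra -/

open Classical in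
/-- The linear map to the group algebra which sends the diagrams of permutations to group elements
and all other diagrams to zero. -/
def toGroupAlgebraLinear (k : Type u) [CommRing k] (r s : ℕ) (δ : k) :
    BrauerAlgebra k (Fin r ⊕ Fin s) δ →ₗ[k] k[PermPair.{u} r s] :=
  (basis k _ δ).constr k fun d =>
    if h : ∃ g : PermPair.{u} r s, ofPermPair g = d then MonoidAlgebra.of k _ h.choose else 0

theorem toGroupAlgebraLinear_ofPermPair (g : PermPair.{u} r s) :
    toGroupAlgebraLinear k r s δ (of δ (ofPermPair g)) = MonoidAlgebra.of k _ g := by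
  have h : ∃ g' : PermPair.{u} r s, ofPermPair g' = ofPermPair g := ⟨g, rfl⟩
  rw [toGroupAlgebraLinear, of, Module.Basis.constr_basis, dif_pos h,
    ofPermPair_injective h.choose_spec]

theorem toGroupAlgebraLinear_of_not_isPermutation {d : BrauerDiagram (Fin r ⊕ Fin s)}
    (hd : ¬ d.IsPermutation) : toGroupAlgebraLinear k r s δ (of δ d) = 0 := by
  rw [toGroupAlgebraLinear, of, Module.Basis.constr_basis, dif_neg]
  rintro ⟨g, rfl⟩
  exact hd (isPermutation_ofPermPair g)

/-- Used to find the kernel: an element with image zero has no permutation diagram in its support.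
-/
theorem coeff_toGroupAlgebraLinear (a : BrauerAlgebra k (Fin r ⊕ Fin s) δ)
    (ha : a ∈ walledBrauerAlgebra k r s δ) (g : PermPair.{u} r s) :
    (toGroupAlgebraLinear k r s δ a).coeff g = (basis k _ δ).repr a (ofPermPair g) := by
  refine eqOn_spanOf
    (f := Finsupp.lapply g ∘ₗ (MonoidAlgebra.coeffLinearEquiv k).toLinearMap ∘ₗ
      toGroupAlgebraLinear k r s δ)
    (g := Finsupp.lapply (ofPermPair g) ∘ₗ (basis k _ δ).repr.toLinearMap)
    (fun d hd => ?_) (mem_iff.1 ha)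
  change (toGroupAlgebraLinear k r s δ (of δ d)).coeff g =
    (basis k _ δ).repr (basis k _ δ d) (ofPermPair g)
  classical
  rw [Module.Basis.repr_self]
  by_cases h : d.IsPermutation
  · obtain ⟨g', rfl⟩ := IsWalled.exists_ofPermPair.{u} hd h
    rw [toGroupAlgebraLinear_ofPermPair, MonoidAlgebra.of_apply, MonoidAlgebra.coeff_single,
      Finsupp.single_apply, Finsupp.single_apply]
    simp only [ofPermPair_injective.eq_iff]
  · rw [toGroupAlgebraLinear_of_not_isPermutation h, Finsupp.single_eq_of_ne]
    · rfl
    · rintro rfl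
      exact h (isPermutation_ofPermPair g)

/-- Checked on pairs of walled diagrams. A product is a permutation exactly if both factors are, and
then no loops, hence no powers of `δ`, occur; in all other cases both sides vanish. -/
theorem toGroupAlgebraLinear_mul {a b : BrauerAlgebra k (Fin r ⊕ Fin s) δ}
    (ha : a ∈ walledBrauerAlgebra k r s δ) (hb : b ∈ walledBrauerAlgebra k r s δ) :
    toGroupAlgebraLinear k r s δ (a * b) =
      toGroupAlgebraLinear k r s δ a * toGroupAlgebraLinear k r s δ b := by
  set Φ := toGroupAlgebraLinear k r s δ
  refine eqOn_spanOf (f := Φ ∘ₗ LinearMap.mulLeft k a) (g := LinearMap.mulLeft k (Φ a) ∘ₗ Φ)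
    (fun e he => ?_) (mem_iff.1 hb)
  refine eqOn_spanOf (f := Φ ∘ₗ LinearMap.mulRight k (of δ e))
    (g := LinearMap.mulRight k (Φ (of δ e)) ∘ₗ Φ) (fun d hd => ?_) (mem_iff.1 ha)
  rw [LinearMap.comp_apply, LinearMap.comp_apply, LinearMap.mulRight_apply,
    LinearMap.mulRight_apply, of_mul_of, map_smul]
  by_cases h : (d * e).IsPermutation
  · obtain ⟨h₁, h₂⟩ := (isPermutation_mul_iff d e).1 h
    obtain ⟨g₁, rfl⟩ := IsWalled.exists_ofPermPair.{u} hd h₁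
    obtain ⟨g₂, rfl⟩ := IsWalled.exists_ofPermPair.{u} he h₂
    rw [h₁.loops_eq_zero, pow_zero, one_smul, ← ofPermPair_mul, toGroupAlgebraLinear_ofPermPair,
      toGroupAlgebraLinear_ofPermPair, toGroupAlgebraLinear_ofPermPair, map_mul]
  · rw [toGroupAlgebraLinear_of_not_isPermutation h, smul_zero]
    rw [isPermutation_mul_iff, not_and_or] at h
    rcases h with h | h <;> simp [Φ, toGroupAlgebraLinear_of_not_isPermutation h]

variable (k r s δ) in
/-- The surjection from the walled Brauer algebra to the group algebra. -/
def toGroupAlgebra : walledBrauerAlgebra k r s δ →ₐ[k] k[PermPair.{u} r s] :=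
  AlgHom.ofLinearMap (toGroupAlgebraLinear k r s δ ∘ₗ (walledBrauerAlgebra k r s δ).val.toLinearMap)
    (by
      change toGroupAlgebraLinear k r s δ (of δ 1) = 1
      rw [← ofPermPair_one.{u}, toGroupAlgebraLinear_ofPermPair, map_one])
    (fun a b => toGroupAlgebraLinear_mul a.2 b.2)

variable (k r s δ) in
/-- The section of `toGroupAlgebra`, given by the diagrams of permutations. -/
def ofGroup : PermPair.{u} r s →* walledBrauerAlgebra k r s δ where
  toFun g := ⟨of δ (ofPermPair g), of_mem (isWalled_ofPermPair g)⟩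
  map_one' := Subtype.ext (congrArg (of δ) ofPermPair_one)
  map_mul' g h := Subtype.ext (by
    change of δ (ofPermPair (g * h)) = of δ (ofPermPair g) * of δ (ofPermPair h)
    rw [ofPermPair_mul, of_mul_of, (isPermutation_ofPermPair g).loops_eq_zero, pow_zero, one_smul])

theorem toGroupAlgebra_ofGroup (g : PermPair.{u} r s) :
    toGroupAlgebra k r s δ (ofGroup k r s δ g) = MonoidAlgebra.of k _ g :=
  toGroupAlgebraLinear_ofPermPair g

theorem augmentation_eq (a : walledBrauerAlgebra k r s δ) :
    walledBrauerAugmentation k r s δ a =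
      MonoidAlgebra.lift k k (PermPair.{u} r s) 1 (toGroupAlgebra k r s δ a) := by
  refine eqOn_spanOf (f := (BrauerAlgebra.augmentation k (Fin r ⊕ Fin s) δ).toLinearMap)
    (g := (MonoidAlgebra.lift k k (PermPair.{u} r s) 1).toLinearMap ∘ₗ
      toGroupAlgebraLinear k r s δ) (fun d hd => ?_) (mem_iff.1 a.2)
  classical
  have h₁ : BrauerAlgebra.augmentation k (Fin r ⊕ Fin s) δ (of δ d) =
      if d.IsPermutation then 1 else 0 := by
    rw [BrauerAlgebra.augmentation, of, AlgHom.ofLinearMap_apply, Module.Basis.constr_basis]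
  rw [AlgHom.toLinearMap_apply, h₁, LinearMap.comp_apply, AlgHom.toLinearMap_apply]
  split_ifs with h
  · obtain ⟨g, rfl⟩ := IsWalled.exists_ofPermPair.{u} hd h
    rw [toGroupAlgebraLinear_ofPermPair, MonoidAlgebra.lift_of, MonoidHom.one_apply]
  · rw [toGroupAlgebraLinear_of_not_isPermutation h, map_zero]

/-- The kernel is spanned by the walled diagrams that are not permutations, and these are the walled
diagrams with at least one arc in the left-hand column. Writing it as a supremum over single arcs
prepares the use of `ChainComplex.AcyclicOn.finset_sup`. -/
theorem ker_toGroupAlgebra : (RingHom.ker (toGroupAlgebra k r s δ)).toAddSubgroup =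
    supported k δ ((Finset.univ : Finset (Fin r × Fin s)).sup fun e => withEdges {e}) := by
  ext a
  rw [mem_supported]
  constructor
  · intro ha
    have h : (a : BrauerAlgebra k (Fin r ⊕ Fin s) δ) ∈ spanOf k δ {d | d.IsWalled} :=
      mem_iff.1 a.2
    rw [mem_spanOf] at h ⊢
    intro d hd
    by_cases hperm : d.IsPermutation
    · obtain ⟨g, rfl⟩ := IsWalled.exists_ofPermPair.{u} (h d hd) hperm
      rw [← coeff_toGroupAlgebraLinear _ a.2] at hd
      have h0 : toGroupAlgebraLinear k r s δ a = 0 := ha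
      rw [h0] at hd
      exact absurd rfl hd
    · obtain ⟨e, he⟩ := IsWalled.exists_mem_withEdges (h d hd) hperm
      exact Finset.le_sup (f := fun e : Fin r × Fin s => withEdges {e}) (Finset.mem_univ e) he
  · intro ha
    refine eqOn_spanOf (f := toGroupAlgebraLinear k r s δ) (g := 0) (fun d hd => ?_) ha
    rw [Finset.sup_eq_iSup] at hd
    simp only [Set.iSup_eq_iUnion, Set.mem_iUnion] at hd
    obtain ⟨e, -, he⟩ := hd
    exact toGroupAlgebraLinear_of_not_isPermutation
      (withEdges_not_isPermutation (Set.singleton_nonempty e) he)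

theorem augmentation_eq_zero {S : Set (Fin r × Fin s)} (hS : S.Nonempty)
    {a : walledBrauerAlgebra k r s δ} (ha : a ∈ supported k δ (withEdges S)) :
    walledBrauerAugmentation k r s δ a = 0 := by
  have : toGroupAlgebra.{u} k r s δ a = 0 :=
    eqOn_spanOf (f := toGroupAlgebraLinear k r s δ) (g := 0)
      (fun d hd => toGroupAlgebraLinear_of_not_isPermutation (withEdges_not_isPermutation hS hd)) ha
  rw [augmentation_eq, this, map_zero]

/-- For an invertible parameter, the ideal spanned by the diagrams which are not permutations is
acyclic on projective resolutions of the trivial module. -/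
theorem acyclicOn_ker (hδ : IsUnit δ)
    (P : ProjectiveResolution (AugmentedAlgebra.trivialLeft (walledBrauerAugmentation k r s δ))) :
    P.complex.AcyclicOn (RingHom.ker (toGroupAlgebra k r s δ)).toAddSubgroup := by
  classical
  rw [ker_toGroupAlgebra]
  -- Only nonempty `S` are admitted: for empty `S` the ideal is the whole algebra, whose unit does
  -- not act as zero on the trivial module. Nonempty sets of arcs are closed under unions, so the
  -- family is still closed under intersections.
  refine (ChainComplex.AcyclicOn.finset_sup (supported k δ) supported_empty supported_sup
    supported_inf {D | ∃ S : Finset (Fin r × Fin s), S.Nonempty ∧ D = withEdges S} ?_ ?_ ?_ _ _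
    ?_).2
  · rintro _ ⟨S, hS, rfl⟩ _ ⟨T, -, rfl⟩
    exact ⟨S ∪ T, hS.mono Finset.subset_union_left, by
      rw [Finset.coe_union, withEdges_union]; rfl⟩
  · rintro _ ⟨S, -, rfl⟩ a ha b
    exact mul_mem_supported _ ha b
  · rintro _ ⟨S, hS, rfl⟩
    obtain ⟨e, he, hid⟩ := exists_leftUnit hδ hS
    refine P.acyclicOn_of_leftUnit he hid fun z => ?_
    exact AugmentedAlgebra.trivialLeft_smul_eq_zero (augmentation_eq_zero hS he) z
  · exact fun e _ => ⟨{e}, Finset.singleton_nonempty e, by rw [Finset.coe_singleton]⟩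

end

end walledBrauerAlgebra

theorem theorem8p1 {k : Type u} [CommRing k] (r s : ℕ) (δ : k) (hδ : IsUnit δ) :
    (∀ n : ℕ, Nonempty (AugmentedAlgebra.homology (walledBrauerAugmentation k r s δ) n ≃ₗ[k]
      groupHomology
        (Rep.trivial k (ULift.{u} (Equiv.Perm (Fin r) × Equiv.Perm (Fin s))) k) n)) ∧
    (∀ n : ℕ, Nonempty (AugmentedAlgebra.cohomology (walledBrauerAugmentation k r s δ) n ≃ₗ[k]
      groupCohomology
        (Rep.trivial k (ULift.{u} (Equiv.Perm (Fin r) × Equiv.Perm (Fin s))) k) n)) := by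
  let P := projectiveResolution
    (AugmentedAlgebra.trivialLeft (walledBrauerAugmentation k r s δ))
  have hP := walledBrauerAlgebra.acyclicOn_ker hδ P
  exact ⟨AugmentedAlgebra.nonempty_homology_equiv walledBrauerAlgebra.toGroupAlgebra_ofGroup
      walledBrauerAlgebra.augmentation_eq P hP,
    AugmentedAlgebra.nonempty_cohomology_equiv walledBrauerAlgebra.toGroupAlgebra_ofGroup
      walledBrauerAlgebra.augmentation_eq P hP⟩
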